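/- Consider the M/G/1/N queue with server vacations and exhaustive service. Customers arrive in a Poisson process with rate $\lambda>0$; the system holds at most $N\ge 1$ customers, including the one in service, and a customer who arrives when $N$ customers are present is lost. Whenever the system becomes empty, the server takes a vacation of random length; if the system is still empty when it ends, the server takes another one, and so on; otherwise the server serves customers one at a time until the system is empty again. The service times are i.i.d. copies of $S\ge 0$, the vacation times are i.i.d. copies of $V\ge 0$, and arrivals, service times and vacation times are independent. Assume that $E[S]<\infty$, $E[V]<\infty$ and $P(V>0)>0$. The system starts empty at time $0$, with the server beginning a vacation. Let $L(t)$ be the number of customers in the system at time $t$, and let $P_{\mathrm{loss}}(N)$ be the steady-state probability that an arriving customer is lost, i.e. $P_{\mathrm{loss}}(N)=\lim_{n\to\infty}P(L(\sigma_n-)=N)$, where $\sigma_n$ is the arrival epoch of the $n$-th customer. Put $\rho=\lambda E[S]$, $S^*(t)=E[e^{-tS}]$, $V^*(t)=E[e^{-tV}]$, and write ${S^*}'(\lambda-\lambda z)=\frac{d}{du}S^*(\lambda-\lambda u)\big|_{u=z}$. **Theorem.** Assume that $\rho>1$. Then the equation $z=S^*(\lambda-\lambda z)$ has exactly one solution $z_2\in(0,1)$,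 the limit defining $P_{\mathrm{loss}}(N)$ exists for every $N\ge 1$, and $$\lim_{N\to\infty} z_2^{-N}\left[P_{\mathrm{loss}}(N)-\left(1-\frac1\rho\right)\right]=\frac{(1-z_2)\,\bigl[1-{S^*}'(\lambda-\lambda z_2)\bigr]\,E[V]}{z_2\,\rho\,E[S]\,\bigl[1-V^*(\lambda-\lambda z_2)\bigr]}.$$ -/

import Mathlib

open MeasureTheory ProbabilityTheory Filter Topology Set
open scoped NNReal

namespace VacationQueue

/-- The Laplace(-Stieltjes) transform `F*(s) = ∫ e^{-s x} dF(x)` at a real argument `s`,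
of the distribution `μ` on `ℝ`. -/
noncomputable def laplace (μ : Measure ℝ) (s : ℝ) : ℝ :=
  ∫ x, Real.exp (-(s * x)) ∂μ

/-! ### The sample path of the queue

Fix one realisation: `σ n` is the arrival epoch of customer `n` (`n = 0, 1, 2, …`).
The activities of the server (single services or single vacations) are numbered
`k = 0, 1, 2, …` in the order in which they are performed; if activity `k` is a service it lasts
for the time `S k`, and if it is a vacation it lasts for the time `V k`.
At time `0` the system is empty and the server starts a vacation. -/

/-- The number of arrivals in the time interval up to and including `t`. -/
noncomputable def arrivalCount (σ : ℕ → ℝ) (t : ℝ) : ℕ :=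
  {n : ℕ | σ n ≤ t}.ncard

/-- The pair (number of customers in the system, time) at the beginning of activity `k` of the
server in the system of capacity `N` (including the customer in service).
If the system is empty, then the activity is a vacation, otherwise it is a service; no customer
leaves before the end of the activity, those who arrive while there are already `N` customers in
the system are lost, and at the end of a service exactly one customer departs. -/
noncomputable def activityStart (N : ℕ) (σ S V : ℕ → ℝ) : ℕ → ℕ × ℝ
  | 0 => (0, 0)
  | k + 1 =>
    let x : ℕ := (activityStart N σ S V k).1
    let t : ℝ := (activityStart N σ S V k).2
    let t' : ℝ := t + (if x = 0 then V k else S k)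
    let y : ℕ := min (x + (arrivalCount σ t' - arrivalCount σ t)) N
    (if x = 0 then y else y - 1, t')

/-- The index of the activity that is in progress at time `t`: the number of activities that have
been completed up to and including time `t`. -/
noncomputable def currentActivity (N : ℕ) (σ S V : ℕ → ℝ) (t : ℝ) : ℕ :=
  {j : ℕ | (activityStart N σ S V (j + 1)).2 ≤ t}.ncard

/-- The number `L(t)` of customers in the system of capacity `N` at time `t`. -/
noncomputable def queueLength (N : ℕ) (σ S V : ℕ → ℝ) (t : ℝ) : ℕ :=
  let a : ℕ × ℝ := activityStart N σ S V (currentActivity N σ S V t)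
  min (a.1 + (arrivalCount σ t - arrivalCount σ a.2)) N

/-- Customer `n` is lost: just before the arrival epoch `σ n` the system contains `N` customers,
that is, `L(σ n -) = N`. -/
def IsLost (N : ℕ) (σ S V : ℕ → ℝ) (n : ℕ) : Prop :=
  ∀ᶠ t in 𝓝[<] (σ n), queueLength N σ S V t = N

/-! ### The stochastic model -/

/-- The points `σ 0 < σ 1 < ⋯` form a Poisson process on `(0, ∞)` with rate `lam`: they do not
accumulate, and the counting process has independent increments, the increment over `(s, t]`
being Poisson distributed with mean `lam * (t - s)`. -/
structure IsPoissonArrivals {Ω : Type*} [MeasurableSpace Ω] (P : Measure Ω) (lam : ℝ)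
    (σ : ℕ → Ω → ℝ) : Prop where
  measurable : ∀ n, Measurable (σ n)
  pos : ∀ᵐ ω ∂P, 0 < σ 0 ω
  strictMono : ∀ᵐ ω ∂P, StrictMono (fun n => σ n ω)
  tendsto : ∀ᵐ ω ∂P, Tendsto (fun n => σ n ω) atTop atTop
  indepIncrements :
    HasIndepIncrements (fun (t : ℝ≥0) ω => arrivalCount (fun n => σ n ω) (t : ℝ)) P
  increments : ∀ s t : ℝ≥0, s ≤ t →
    HasLaw (fun ω => arrivalCount (fun n => σ n ω) (t : ℝ) - arrivalCount (fun n => σ n ω) (s : ℝ))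
      (poissonMeasure (Real.toNNReal (lam * ((t : ℝ) - (s : ℝ))))) P

/-- The random input of the M/G/1/N-(V,E)-queue: Poisson arrivals with rate `lam`, independent
service times with distribution `μS`, independent vacation times with distribution `μV`; service
times, vacation times and the arrival process are independent. -/
structure IsInput {Ω : Type*} [MeasurableSpace Ω] (P : Measure Ω) (lam : ℝ) (μS μV : Measure ℝ)
    (σ S V : ℕ → Ω → ℝ) : Prop where
  arrivals : IsPoissonArrivals P lam σ
  measurable_service : ∀ k, Measurable (S k)
  measurable_vacation : ∀ k, Measurable (V k)
  service_law : ∀ k, P.map (S k) = μS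
  vacation_law : ∀ k, P.map (V k) = μV
  indep_durations : iIndepFun (Sum.elim S V : ℕ ⊕ ℕ → Ω → ℝ) P
  indep_arrivals : IndepFun (fun ω (n : ℕ) => σ n ω) (fun ω (k : ℕ) => (S k ω, V k ω)) P

/-- `p` is the loss probability of the queue with capacity `N`: the steady-state probability
`lim_{n → ∞} P(customer n is lost)` that an arriving customer finds no free room. -/
def IsLossProbability {Ω : Type*} [MeasurableSpace Ω] (P : Measure Ω) (N : ℕ)
    (σ S V : ℕ → Ω → ℝ) (p : ℝ) : Prop :=
  Tendsto
    (fun n : ℕ => P.real {ω | IsLost N (fun k => σ k ω) (fun k => S k ω) (fun k => V k ω) n})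
    atTop (𝓝 p)

end VacationQueue

/-! The queue is observed in customer numbers instead of time. Let $a_b$ and $v_b$ be the
probabilities of $b$ arrivals during a service and during a vacation; both are mixed Poisson laws.
If $x$ customers are present when an activity begins, then $b$ arrivals during it determine the next
state, and the successive arrival counts have the law of a Markov chain
(`measure_arrivalsDuring_eq`). The probability that customer $n$, counted from now, is lost
therefore satisfies a Markov renewal equation on $\{0,\dots,N\}$ in which an activity with $b$
arrivals shifts $n$ by $b$. By the key renewal theorem `tendsto_renewal` the limit exists and equals
mean losses per activity divided by mean arrivals per activity, both taken under the stationary law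
of the chain. With $E_N$ (`cycleServices`) the mean number of services per cycle this gives
$P_{loss}(N) = 1 - E_N/(\lambda E[V] + \rho E_N)$, that is, $P_{loss}(N) - (1 - 1/\rho) = \lambda
E[V] / (\rho(\lambda E[V] + \rho E_N))$.

It remains to find the growth of $E_N$. Let $h_n$ (`ladder`) be the mean number of services that
lower the queue by one when $n$ places are free, and let $t_i = \sum_{b>i} a_b$. Then $h_n = 1 +
\sum_{i<n} t_i h_{n-i}$. The function $T(u) = \sum t_i u^i = (1 - S^*(\lambda - \lambda u))/(1-u)$
increases from $1 - a_0 < 1$ to $\rho > 1$, so $T(z) = 1$ has one root in $(0,1)$; on $(0,1)$ this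
is the fixed point equation. The weights $t_i z^i$ form a probability law with some mean $D$, and
$h_n z^n$ solves a renewal equation for it. The same renewal theorem, now with one state, gives $h_n
z^n \to (z/(1-z))/D$. Since $E_N$ is a convolution of $h$ with the tails of $v$, $z^N E_N$ converges
as well; $D$ is expressed by the derivative of $S^*$ in `one_sub_deriv_gen`.

The renewal theorem is proved by compactness: limits along an ultrafilter that realises the limsup
are averages of themselves and attain their maximum, so they are eventually constant, and a
conserved quantity identifies the constant. -/

namespace VacationQueue

/-! ### Markov renewal equations on a finite state space -/

/-- A stochastic matrix on a finite nonempty index type has a stationary distribution. -/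
theorem exists_stationary {ι : Type*} [Fintype ι] [Nonempty ι]
    (Q : ι → ι → ℝ) (hQ : ∀ x y, 0 ≤ Q x y) (hrow : ∀ x, ∑ y, Q x y = 1) :
    ∃ w : ι → ℝ, (∀ x, 0 ≤ w x) ∧ ∑ x, w x = 1 ∧ ∀ y, ∑ x, w x * Q x y = w y := by
  classical
  -- Constants form a right null vector of `Q - 1`, so there is also a left null vector `v`.
  -- Entrywise $|v| \le |v|Q$, and both sides have the same total mass, so $|v|$ is stationary too.
  have hdet : (Matrix.of Q - 1).det = 0 := by
    rw [← Matrix.exists_mulVec_eq_zero_iff]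
    refine ⟨fun _ => 1, ?_, ?_⟩
    · intro h
      have := congrFun h (Classical.arbitrary ι)
      simp at this
    · ext x
      simp only [Matrix.sub_mulVec, Matrix.one_mulVec, Pi.sub_apply, Pi.zero_apply]
      simp [Matrix.mulVec, dotProduct, hrow]
  obtain ⟨v, hv0, hv⟩ := Matrix.exists_vecMul_eq_zero_iff.mpr hdet
  have hv' : ∀ y, ∑ x, v x * Q x y = v y := by
    intro y
    have := congrFun hv y
    simp only [Matrix.vecMul_sub, Matrix.vecMul_one, Pi.sub_apply, Pi.zero_apply] at this
    simpa [Matrix.vecMul, dotProduct, sub_eq_zero] using this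
  have hle : ∀ y, |v y| ≤ ∑ x, |v x| * Q x y := by
    intro y
    conv_lhs => rw [← hv' y]
    refine (Finset.abs_sum_le_sum_abs _ _).trans (Finset.sum_le_sum fun x _ => ?_)
    rw [abs_mul, abs_of_nonneg (hQ x y)]
  have htot : ∑ y, (∑ x, |v x| * Q x y - |v y|) = 0 := by
    rw [Finset.sum_sub_distrib, Finset.sum_comm]
    simp [← Finset.mul_sum, hrow]
  have heq : ∀ y, ∑ x, |v x| * Q x y = |v y| := by
    intro y
    have := (Finset.sum_eq_zero_iff_of_nonneg (fun y _ => sub_nonneg.mpr (hle y))).mp htot y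
      (Finset.mem_univ y)
    linarith
  have hpos : 0 < ∑ x, |v x| := by
    obtain ⟨x, hx⟩ := Function.ne_iff.mp hv0
    exact Finset.sum_pos' (fun x _ => abs_nonneg _) ⟨x, Finset.mem_univ x, abs_pos.mpr hx⟩
  refine ⟨fun x => |v x| / ∑ x, |v x|, fun x => by positivity, ?_, fun y => ?_⟩
  · rw [← Finset.sum_div, div_self hpos.ne']
  · beta_reduce
    conv_rhs => rw [← heq y, Finset.sum_div]
    exact Finset.sum_congr rfl fun x _ => by ring

theorem summable_mul_of_abs_le {p f : ℕ → ℝ} (hp : ∀ b, 0 ≤ p b) (hs : Summable p) {K : ℝ}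
    (hf : ∀ b, |f b| ≤ K) : Summable fun b => p b * f b := by
  refine Summable.of_norm_bounded (hs.mul_left K) fun b => ?_
  rw [Real.norm_eq_abs, abs_mul, abs_of_nonneg (hp b), mul_comm]
  exact mul_le_mul_of_nonneg_right (hf b) (hp b)

/-- If an average with positive weights attains an upper bound of the averaged values, then all
these values attain it. -/
theorem eq_of_average_eq_bound {p f : ℕ → ℝ} (hp : ∀ b, 0 < p b) (hsum : HasSum p 1)
    {K U : ℝ} (hf : ∀ b, |f b| ≤ K) (hU : ∀ b, f b ≤ U) (hav : ∑' b, p b * f b = U) (b : ℕ) :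
    f b = U := by
  have h1 : HasSum (fun b => p b * f b) U := by
    rw [← hav]
    exact (summable_mul_of_abs_le (fun b => (hp b).le) hsum.summable hf).hasSum
  have h2 : HasSum (fun b => p b * (U - f b)) 0 := by
    have := (hsum.mul_right U).sub h1
    simpa [mul_sub] using this
  have h3 := (hasSum_zero_iff_of_nonneg
    (fun b => mul_nonneg (hp b).le (sub_nonneg.mpr (hU b)))).mp h2
  have := congrFun h3 b
  simp only [Pi.zero_apply, mul_eq_zero, (hp b).ne', false_or] at this
  linarith

/-- The value of `l` at time `n - j`, taken to be zero for negative times. -/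
noncomputable def lagged {ι : Type*} (l : ℕ → ι → ℝ) (n j : ℕ) (x : ι) : ℝ :=
  if j ≤ n then l (n - j) x else 0

theorem abs_lagged_le {ι : Type*} {l : ℕ → ι → ℝ} {K : ℝ} (hl : ∀ n x, |l n x| ≤ K)
    (n j : ℕ) (x : ι) : |lagged l n j x| ≤ K := by
  unfold lagged
  split_ifs
  · exact hl _ _
  · simpa using (abs_nonneg _).trans (hl 0 x)

theorem lagged_succ_succ {ι : Type*} (l : ℕ → ι → ℝ) (n j : ℕ) (x : ι) :
    lagged l (n + 1) (j + 1) x = lagged l n j x := by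
  simp [lagged]

theorem lagged_zero_right {ι : Type*} (l : ℕ → ι → ℝ) (n : ℕ) (x : ι) :
    lagged l n 0 x = l n x := by
  simp [lagged]

theorem sum_lagged_succ {ι : Type*} (l : ℕ → ι → ℝ) (n b : ℕ) (x : ι) :
    ∑ j ∈ Finset.range b, lagged l (n + 1) j x =
      ∑ j ∈ Finset.range b, lagged l n j x + l (n + 1) x - lagged l (n + 1) b x := by
  have h1 := Finset.sum_range_succ (fun j => lagged l (n + 1) j x) b
  have h2 := Finset.sum_range_succ' (fun j => lagged l (n + 1) j x) b
  simp only [lagged_succ_succ, lagged_zero_right] at h2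
  linarith

theorem tsum_mul_lagged {ι : Type*} (l : ℕ → ι → ℝ) (p : ℕ → ℝ) (nxt : ℕ → ι) (n : ℕ) :
    ∑' b, p b * lagged l n b (nxt b) =
      ∑ b ∈ Finset.range (n + 1), p b * l (n - b) (nxt b) := by
  rw [tsum_eq_sum (s := Finset.range (n + 1))]
  · refine Finset.sum_congr rfl fun b hb => ?_
    rw [lagged, if_pos (Nat.lt_succ_iff.mp (Finset.mem_range.mp hb))]
  · intro b hb
    rw [lagged, if_neg (by simpa [Nat.lt_succ_iff] using hb), mul_zero]

theorem abs_sum_lagged_le {ι : Type*} {l : ℕ → ι → ℝ} {K : ℝ} (hl : ∀ n x, |l n x| ≤ K)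
    (n b : ℕ) (x : ι) : |∑ j ∈ Finset.range b, lagged l n j x| ≤ K * b := by
  refine (Finset.abs_sum_le_sum_abs _ _).trans ?_
  refine (Finset.sum_le_sum fun j _ => abs_lagged_le hl n j x).trans ?_
  simp [mul_comm]

theorem summable_mul_sum_lagged {ι : Type*} {l : ℕ → ι → ℝ} {K : ℝ} (hl : ∀ n x, |l n x| ≤ K)
    {p : ℕ → ℝ} (hp : ∀ b, 0 ≤ p b) (hmean : Summable fun b : ℕ => (b : ℝ) * p b)
    (nxt : ℕ → ι) (n : ℕ) :
    Summable fun b => p b * ∑ j ∈ Finset.range b, lagged l n j (nxt b) := by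
  refine Summable.of_norm_bounded (hmean.mul_left K) fun b => ?_
  rw [Real.norm_eq_abs, abs_mul, abs_of_nonneg (hp b)]
  nlinarith [mul_le_mul_of_nonneg_right (abs_sum_lagged_le hl n b (nxt b)) (hp b)]

theorem tendsto_lagged_sub {ι : Type*} {l : ℕ → ι → ℝ} {F : Filter ℕ} (hF : F ≤ atTop) (θ : ℕ → ι → ℝ)
    (hθ : ∀ i x, Tendsto (fun n => l (n - i) x) F (𝓝 (θ i x))) (i j : ℕ) (x : ι) :
    Tendsto (fun n => lagged l (n - i) j x) F (𝓝 (θ (i + j) x)) := by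
  refine (hθ (i + j) x).congr' ?_
  filter_upwards [hF (eventually_ge_atTop (i + j))] with n hn
  rw [lagged, if_pos (by omega), Nat.sub_sub]

section Renewal

variable {ι : Type*} [Fintype ι] {p : ι → ℕ → ℝ} {nxt : ι → ℕ → ι} {w : ι → ℝ}
  {l c : ℕ → ι → ℝ} {K : ℝ}

/-- The conserved quantity of a Markov renewal equation. -/
theorem renewal_conservation (hp : ∀ x b, 0 < p x b) (hsum : ∀ x, HasSum (p x) 1)
    (hmean : ∀ x, Summable fun b : ℕ => (b : ℝ) * p x b)
    (hw : ∀ g : ι → ℝ, ∑ x, w x * ∑' b, p x b * g (nxt x b) = ∑ x, w x * g x)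
    (hl : ∀ n x, |l n x| ≤ K)
    (heq : ∀ n x, l n x = c n x + ∑ b ∈ Finset.range (n + 1), p x b * l (n - b) (nxt x b))
    (n : ℕ) :
    ∑ x, w x * ∑' b, p x b * ∑ j ∈ Finset.range b, lagged l n j (nxt x b) =
      ∑ k ∈ Finset.range (n + 1), ∑ x, w x * c k x := by
  have hp0 : ∀ x b, 0 ≤ p x b := fun x b => (hp x b).le
  have hc : ∀ n x, c n x = l n x - ∑' b, p x b * lagged l n b (nxt x b) := by
    intro n x
    rw [tsum_mul_lagged]
    linarith [heq n x]
  -- Stationarity, tested on `l n`, replaces $l_n(x)$ by its average over the next states. This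
  -- makes the contribution of `c n` equal to the increment of the left side in the induction below.
  have hstep : ∀ n, ∑ x, w x * c n x =
      ∑ x, w x * ∑' b, p x b * (l n (nxt x b) - lagged l n b (nxt x b)) := by
    intro n
    have : ∀ x, ∑' b, p x b * (l n (nxt x b) - lagged l n b (nxt x b)) =
        ∑' b, p x b * l n (nxt x b) - ∑' b, p x b * lagged l n b (nxt x b) := by
      intro x
      rw [← Summable.tsum_sub]
      · simp only [mul_sub]
      · exact summable_mul_of_abs_le (hp0 x) (hsum x).summable fun b => hl n _
      · exact summable_mul_of_abs_le (hp0 x) (hsum x).summable fun b => abs_lagged_le hl n b _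
    simp only [hc, this]
    simp only [mul_sub, Finset.sum_sub_distrib, hw (l n)]
  induction n with
  | zero =>
    rw [zero_add, Finset.sum_range_one, hstep]
    refine Finset.sum_congr rfl fun x _ => ?_
    congr 1
    refine tsum_congr fun b => ?_
    congr 1
    cases b with
    | zero => simp [lagged]
    | succ b =>
      rw [Finset.sum_range_succ', Finset.sum_eq_zero]
      · simp [lagged]
      · intro j _
        simp [lagged]
  | succ n ih =>
    rw [Finset.sum_range_succ, ← ih, hstep, ← Finset.sum_add_distrib]
    refine Finset.sum_congr rfl fun x _ => ?_
    rw [← mul_add, ← Summable.tsum_add]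
    · congr 1
      refine tsum_congr fun b => ?_
      rw [sum_lagged_succ]
      ring
    · exact summable_mul_sum_lagged hl (hp0 x) (hmean x) _ _
    · refine summable_mul_of_abs_le (K := K + K) (hp0 x) (hsum x).summable fun b => ?_
      exact (abs_sub _ _).trans (add_le_add (hl _ _) (abs_lagged_le hl _ _ _))

/-- The limsup $U$ of the maximum over the states is shown to be exactly the claimed limit. Along an
ultrafilter that realises $U$, the shifted values have limits $\theta_i(x) \le U$ which satisfy the
equation without the forcing term. The maximum principle and `hreach` force $\theta_i = U$ for all
large $i$, and the conservation law evaluated there determines $U$. -/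
theorem renewal_limsup_le [Nonempty ι] (hp : ∀ x b, 0 < p x b) (hsum : ∀ x, HasSum (p x) 1)
    (hmean : ∀ x, Summable fun b : ℕ => (b : ℝ) * p x b)
    (hw : ∀ g : ι → ℝ, ∑ x, w x * ∑' b, p x b * g (nxt x b) = ∑ x, w x * g x)
    (hpos : 0 < ∑ x, w x * ∑' b : ℕ, (b : ℝ) * p x b)
    (hreach : ∀ T : ℕ → ι → Prop, (∃ x, T 0 x) → (∀ i x b, T i x → T (i + b) (nxt x b)) →
      ∃ i₀, ∀ i ≥ i₀, ∀ x, T i x)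
    (hl : ∀ n x, |l n x| ≤ K) (hc : ∀ x, Summable fun n => c n x)
    (heq : ∀ n x, l n x = c n x + ∑ b ∈ Finset.range (n + 1), p x b * l (n - b) (nxt x b))
    {u : ℝ} (hu : (∑ x, w x * ∑' n, c n x) / (∑ x, w x * ∑' b : ℕ, (b : ℝ) * p x b) < u) (x : ι) :
    ∀ᶠ n in atTop, l n x < u := by
  have hp0 : ∀ x b, 0 ≤ p x b := fun x b => (hp x b).le
  set g : ℕ → ℝ := fun n => Finset.univ.sup' Finset.univ_nonempty (l n) with hg
  have hlg : ∀ n x, l n x ≤ g n := fun n x => Finset.le_sup' (l n) (Finset.mem_univ x)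
  have hgx : ∀ n, ∃ x, l n x = g n := by
    intro n
    obtain ⟨x, -, hx⟩ := Finset.exists_mem_eq_sup' Finset.univ_nonempty (l n)
    exact ⟨x, hx.symm⟩
  have hgK : ∀ n, |g n| ≤ K := by
    intro n
    obtain ⟨x, hx⟩ := hgx n
    exact hx ▸ hl n x
  have hbdd : IsBoundedUnder (· ≤ ·) atTop g :=
    isBoundedUnder_of ⟨K, fun n => (abs_le.mp (hgK n)).2⟩
  have hbdd' : IsBoundedUnder (· ≥ ·) atTop g :=
    isBoundedUnder_of ⟨-K, fun n => (abs_le.mp (hgK n)).1⟩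
  set U := limsup g atTop with hU
  suffices hkey : U = (∑ x, w x * ∑' n, c n x) / (∑ x, w x * ∑' b : ℕ, (b : ℝ) * p x b) by
    rw [← hkey] at hu
    filter_upwards [eventually_lt_of_limsup_lt hu hbdd] with n hn
    exact (hlg n x).trans_lt hn
  have hcl : MapClusterPt U atTop g :=
    MapClusterPt.limsup hbdd'.isCoboundedUnder_le hbdd
  -- An ultrafilter provides the limits for all shifts `i` and all states at once, in place of a
  -- diagonal extraction.
  obtain ⟨F, hF, hFg⟩ := mapClusterPt_iff_ultrafilter.mp hcl
  have hexθ : ∀ i x, ∃ t, Tendsto (fun n => l (n - i) x) F (𝓝 t) := by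
    intro i x
    have hmem : ((F.map fun n => l (n - i) x : Ultrafilter ℝ) : Filter ℝ) ≤ 𝓟 (Icc (-K) K) := by
      rw [le_principal_iff]
      exact Eventually.of_forall (f := (F : Filter ℕ)) fun n => abs_le.mp (hl (n - i) x)
    obtain ⟨t, -, ht⟩ := isCompact_iff_ultrafilter_le_nhds.mp isCompact_Icc _ hmem
    exact ⟨t, ht⟩
  choose θ hθ using hexθ
  have hθK : ∀ i x, |θ i x| ≤ K := fun i x =>
    le_of_tendsto (hθ i x).abs (Eventually.of_forall fun n => hl _ _)
  have hθU : ∀ i x, θ i x ≤ U := by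
    intro i x
    refine le_of_forall_gt_imp_ge_of_dense fun v hv => ?_
    refine le_of_tendsto (hθ i x) (hF ?_)
    have h1 := eventually_lt_of_limsup_lt (hU ▸ hv) hbdd
    filter_upwards [(tendsto_sub_atTop_nat i).eventually h1] with n hn
    exact ((hlg _ x).trans_lt hn).le
  have hθeq : ∀ i x, ∑' b, p x b * θ (i + b) (nxt x b) = θ i x := by
    intro i x
    have h1 : Tendsto (fun n => ∑' b, p x b * lagged l (n - i) b (nxt x b)) F
        (𝓝 (∑' b, p x b * θ (i + b) (nxt x b))) := by
      refine tendsto_tsum_of_dominated_convergence (bound := fun b => K * p x b)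
        ((hsum x).summable.mul_left K) (fun b => ?_) (Eventually.of_forall fun n b => ?_)
      · exact (tendsto_lagged_sub hF θ hθ i b _).const_mul _
      · rw [Real.norm_eq_abs, abs_mul, abs_of_nonneg (hp0 x b), mul_comm]
        exact mul_le_mul_of_nonneg_right (abs_lagged_le hl _ _ _) (hp0 x b)
    have h2 : Tendsto (fun n => l (n - i) x - c (n - i) x) F (𝓝 (θ i x - 0)) := by
      refine (hθ i x).sub (Tendsto.mono_left ?_ hF)
      exact (hc x).tendsto_atTop_zero.comp (tendsto_sub_atTop_nat i)
    rw [sub_zero] at h2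
    refine tendsto_nhds_unique h1 (h2.congr fun n => ?_)
    rw [tsum_mul_lagged]
    linarith [heq (n - i) x]
  -- The state attaining the maximum varies with `n`, but there are finitely many states, so one of
  -- them attains it on a set of the ultrafilter.
  have hstart : ∃ x, θ 0 x = U := by
    have : ∃ x, ∀ᶠ n in F, l n x = g n := by
      have h1 : ∀ᶠ n in (F : Filter ℕ), ∃ x ∈ (Set.univ : Set ι), l n x = g n :=
        Eventually.of_forall fun n => by simpa using hgx n
      have h2 := (Ultrafilter.finite_biUnion_mem_iff (f := F) (is := (Set.univ : Set ι))
        (s := fun x => {n | l n x = g n}) Set.finite_univ).mp (by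
          filter_upwards [h1] with n hn
          simpa using hn)
      obtain ⟨x, -, hx⟩ := h2
      exact ⟨x, hx⟩
    obtain ⟨x, hx⟩ := this
    refine ⟨x, tendsto_nhds_unique (hθ 0 x) (hFg.congr' ?_)⟩
    filter_upwards [hx] with n hn
    simpa using hn.symm
  obtain ⟨i₀, hi₀⟩ := hreach (fun i x => θ i x = U) hstart fun i x b hix =>
    eq_of_average_eq_bound (hp x) (hsum x) (f := fun b => θ (i + b) (nxt x b))
      (fun b => hθK _ _) (fun b => hθU _ _) ((hθeq i x).trans hix) b
  have hW1 : Tendsto (fun n => ∑ x, w x * ∑' b, p x b *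
      ∑ j ∈ Finset.range b, lagged l (n - i₀) j (nxt x b)) F
      (𝓝 (∑ x, w x * ∑' b, p x b * ∑ j ∈ Finset.range b, θ (i₀ + j) (nxt x b))) := by
    refine tendsto_finsetSum _ fun x _ => Tendsto.const_mul _ ?_
    refine tendsto_tsum_of_dominated_convergence (bound := fun b : ℕ => K * (b * p x b))
      ((hmean x).mul_left K) (fun b => ?_) (Eventually.of_forall fun n b => ?_)
    · exact (tendsto_finsetSum _ fun j _ => tendsto_lagged_sub hF θ hθ i₀ j _).const_mul _
    · rw [Real.norm_eq_abs, abs_mul, abs_of_nonneg (hp0 x b)]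
      nlinarith [mul_le_mul_of_nonneg_right (abs_sum_lagged_le hl (n - i₀) b (nxt x b)) (hp0 x b)]
  -- The shift by `i₀` moves every lag in the conserved quantity into the range where $\theta = U$;
  -- there the inner sum over `j < b` is $bU$.
  have hW2 : Tendsto (fun n => ∑ k ∈ Finset.range (n - i₀ + 1), ∑ x, w x * c k x) F
      (𝓝 (∑ x, w x * ∑' n, c n x)) := by
    refine Tendsto.mono_left ?_ hF
    have h1 : HasSum (fun k => ∑ x, w x * c k x) (∑ x, w x * ∑' n, c n x) :=
      hasSum_sum fun x _ => (hc x).hasSum.mul_left _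
    exact h1.tendsto_sum_nat.comp ((tendsto_add_atTop_nat 1).comp (tendsto_sub_atTop_nat i₀))
  simp only [renewal_conservation hp hsum hmean hw hl heq] at hW1
  have h3 := tendsto_nhds_unique hW1 hW2
  rw [eq_div_iff hpos.ne', ← h3, Finset.mul_sum]
  refine Finset.sum_congr rfl fun x _ => ?_
  rw [mul_left_comm, ← tsum_mul_left]
  congr 1
  refine tsum_congr fun b => ?_
  rw [Finset.sum_congr rfl fun j _ => hi₀ (i₀ + j) (Nat.le_add_right _ _) (nxt x b)]
  simp
  ring

/-- The key renewal theorem for Markov renewal equations on a finite state space. -/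
theorem tendsto_renewal [Nonempty ι] (hp : ∀ x b, 0 < p x b) (hsum : ∀ x, HasSum (p x) 1)
    (hmean : ∀ x, Summable fun b : ℕ => (b : ℝ) * p x b)
    (hw : ∀ g : ι → ℝ, ∑ x, w x * ∑' b, p x b * g (nxt x b) = ∑ x, w x * g x)
    (hpos : 0 < ∑ x, w x * ∑' b : ℕ, (b : ℝ) * p x b)
    (hreach : ∀ T : ℕ → ι → Prop, (∃ x, T 0 x) → (∀ i x b, T i x → T (i + b) (nxt x b)) →
      ∃ i₀, ∀ i ≥ i₀, ∀ x, T i x)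
    (hl : ∀ n x, |l n x| ≤ K) (hc : ∀ x, Summable fun n => c n x)
    (heq : ∀ n x, l n x = c n x + ∑ b ∈ Finset.range (n + 1), p x b * l (n - b) (nxt x b))
    (x : ι) :
    Tendsto (fun n => l n x) atTop
      (𝓝 ((∑ x, w x * ∑' n, c n x) / (∑ x, w x * ∑' b : ℕ, (b : ℝ) * p x b))) := by
  refine tendsto_order.mpr ⟨fun u hu => ?_, fun u hu => ?_⟩
  -- The equation is linear, so the lower bound is the upper bound for `-l` and `-c`.
  · have := renewal_limsup_le (l := fun n x => -l n x) (c := fun n x => -c n x) (u := -u)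
      hp hsum hmean hw hpos hreach (by simpa using hl) (fun x => (hc x).neg)
      (fun n x => by simp [heq n x, add_comm]) (by
        simp only [tsum_neg, mul_neg, Finset.sum_neg_distrib, neg_div]
        linarith) x
    filter_upwards [this] with n hn
    linarith
  · exact renewal_limsup_le hp hsum hmean hw hpos hreach hl hc heq hu x

end Renewal

theorem hasSum_of_forall_eq {ι : Type*} {f g : ι → ℝ} {s : ℝ} (h : HasSum f s)
    (e : ∀ b, f b = g b) : HasSum g s := by
  rwa [funext e] at h

/-! ### Mixed Poisson distributions -/

/-- The Poisson weight with real parameter `r`. -/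
noncomputable def poissonWeight (r : ℝ) (b : ℕ) : ℝ :=
  Real.exp (-r) * r ^ b / (Nat.factorial b)

/-- The law of the number of Poisson arrivals of rate `lam` in an independent random time with
distribution `μ`. -/
noncomputable def poissonMix (lam : ℝ) (μ : Measure ℝ) (b : ℕ) : ℝ :=
  ∫ x, poissonWeight (lam * x) b ∂μ

theorem poissonWeight_nonneg {r : ℝ} (hr : 0 ≤ r) (b : ℕ) : 0 ≤ poissonWeight r b := by
  unfold poissonWeight
  positivity

theorem hasSum_pow_mul_poissonWeight (r u : ℝ) :
    HasSum (fun b : ℕ => u ^ b * poissonWeight r b) (Real.exp (-(r - r * u))) := by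
  have h := (NormedSpace.expSeries_div_hasSum_exp (r * u)).mul_left (Real.exp (-r))
  rw [← Real.exp_eq_exp_ℝ, ← Real.exp_add] at h
  rw [show -(r - r * u) = -r + r * u by ring]
  refine hasSum_of_forall_eq h fun b => ?_
  simp only [poissonWeight, mul_pow]
  ring

theorem hasSum_poissonWeight (r : ℝ) : HasSum (poissonWeight r) 1 := by
  simpa using hasSum_pow_mul_poissonWeight r 1

theorem hasSum_mul_poissonWeight (r : ℝ) :
    HasSum (fun b : ℕ => (b : ℝ) * poissonWeight r b) r := by
  rw [← hasSum_nat_add_iff' 1]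
  simp only [Finset.sum_range_one, Nat.cast_zero, zero_mul, sub_zero]
  have h := (hasSum_poissonWeight r).mul_left r
  rw [mul_one] at h
  refine hasSum_of_forall_eq h fun b => ?_
  simp only [poissonWeight, Nat.factorial_succ, pow_succ]
  push_cast
  field_simp

theorem poissonWeight_le_one {r : ℝ} (hr : 0 ≤ r) (b : ℕ) : poissonWeight r b ≤ 1 :=
  le_hasSum (hasSum_poissonWeight r) b fun j _ => poissonWeight_nonneg hr j

theorem measurable_poissonWeight (lam : ℝ) (b : ℕ) :
    Measurable fun x : ℝ => poissonWeight (lam * x) b := by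
  unfold poissonWeight
  fun_prop

section Mix

variable {lam : ℝ} {μ : Measure ℝ}

theorem integrable_poissonWeight [IsProbabilityMeasure μ] (hlam : 0 < lam)
    (hμ : ∀ᵐ x ∂μ, 0 ≤ x) (b : ℕ) : Integrable (fun x => poissonWeight (lam * x) b) μ := by
  refine Integrable.of_bound (measurable_poissonWeight lam b).aestronglyMeasurable 1 ?_
  filter_upwards [hμ] with x hx
  have h0 : 0 ≤ lam * x := by positivity
  rw [Real.norm_eq_abs, abs_of_nonneg (poissonWeight_nonneg h0 b)]
  exact poissonWeight_le_one h0 b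

theorem hasSum_mul_poissonMix (hlam : 0 < lam) (hμ : ∀ᵐ x ∂μ, 0 ≤ x)
    {c : ℕ → ℝ} (hc : ∀ b, 0 ≤ c b) {G : ℝ → ℝ} (hG : Integrable G μ)
    (hsum : ∀ x, HasSum (fun b => c b * poissonWeight (lam * x) b) (G x)) :
    HasSum (fun b => c b * poissonMix lam μ b) (∫ x, G x ∂μ) := by
  have h := hasSum_integral_of_dominated_convergence (μ := μ)
    (F := fun b x => c b * poissonWeight (lam * x) b) (f := G)
    (fun b x => c b * poissonWeight (lam * x) b)
    (fun b => ((measurable_poissonWeight lam b).const_mul _).aestronglyMeasurable)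
    (fun b => by
      filter_upwards [hμ] with x hx
      rw [Real.norm_eq_abs, abs_of_nonneg]
      exact mul_nonneg (hc b) (poissonWeight_nonneg (by positivity) b))
    (Eventually.of_forall fun x => (hsum x).summable)
    (by simpa only [(hsum _).tsum_eq] using hG)
    (Eventually.of_forall fun x => hsum x)
  exact hasSum_of_forall_eq h fun b => integral_const_mul _ _

theorem poissonMix_nonneg (hlam : 0 < lam) (hμ : ∀ᵐ x ∂μ, 0 ≤ x) (b : ℕ) :
    0 ≤ poissonMix lam μ b := by
  refine integral_nonneg_of_ae ?_
  filter_upwards [hμ] with x hx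
  exact poissonWeight_nonneg (by positivity) b

theorem hasSum_poissonMix [IsProbabilityMeasure μ] (hlam : 0 < lam) (hμ : ∀ᵐ x ∂μ, 0 ≤ x) :
    HasSum (poissonMix lam μ) 1 := by
  have := hasSum_mul_poissonMix hlam hμ (c := fun _ => 1) (fun _ => zero_le_one)
    (G := fun _ => (1 : ℝ)) (integrable_const _) (fun x => by simpa using hasSum_poissonWeight _)
  simpa using this

theorem hasSum_natCast_mul_poissonMix (hlam : 0 < lam) (hμ : ∀ᵐ x ∂μ, 0 ≤ x)
    (hint : Integrable (fun x : ℝ => x) μ) :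
    HasSum (fun b : ℕ => (b : ℝ) * poissonMix lam μ b) (lam * ∫ x, x ∂μ) := by
  have := hasSum_mul_poissonMix hlam hμ (c := fun b => (b : ℝ)) (fun _ => Nat.cast_nonneg _)
    (G := fun x => lam * x) (hint.const_mul _) (fun x => hasSum_mul_poissonWeight _)
  rwa [integral_const_mul] at this

theorem hasSum_pow_mul_poissonMix [IsProbabilityMeasure μ] (hlam : 0 < lam)
    (hμ : ∀ᵐ x ∂μ, 0 ≤ x) {u : ℝ} (hu0 : 0 ≤ u) (hu1 : u ≤ 1) :
    HasSum (fun b : ℕ => u ^ b * poissonMix lam μ b) (laplace μ (lam - lam * u)) := by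
  have h := hasSum_mul_poissonMix hlam hμ (c := fun b => u ^ b) (fun _ => pow_nonneg hu0 _)
    (G := fun x => Real.exp (-((lam - lam * u) * x))) ?_ (fun x => ?_)
  · exact h
  · refine Integrable.of_bound (by fun_prop) 1 ?_
    filter_upwards [hμ] with x hx
    rw [Real.norm_eq_abs, Real.abs_exp, Real.exp_le_one_iff, neg_nonpos]
    have : 0 ≤ lam * (1 - u) := mul_nonneg hlam.le (by linarith)
    nlinarith
  · have := hasSum_pow_mul_poissonWeight (lam * x) u
    rwa [show lam * x - lam * x * u = (lam - lam * u) * x by ring] at this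

theorem poissonMix_pos [IsProbabilityMeasure μ] (hlam : 0 < lam) (hμ : ∀ᵐ x ∂μ, 0 ≤ x)
    (hne : ¬ ∀ᵐ x ∂μ, x = 0) (b : ℕ) : 0 < poissonMix lam μ b := by
  refine (poissonMix_nonneg hlam hμ b).lt_of_ne fun h => hne ?_
  have h0 : 0 ≤ᵐ[μ] fun x => poissonWeight (lam * x) b := by
    filter_upwards [hμ] with x hx
    exact poissonWeight_nonneg (by positivity) b
  have := (integral_eq_zero_iff_of_nonneg_ae h0 (integrable_poissonWeight hlam hμ b)).mp h.symm
  filter_upwards [this] with x hx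
  by_contra hx0
  have : poissonWeight (lam * x) b ≠ 0 := by
    unfold poissonWeight
    have : lam * x ≠ 0 := mul_ne_zero hlam.ne' hx0
    positivity
  exact this hx

end Mix

/-! ### Tails of distributions on the natural numbers -/

/-- The tail `a (i + 1) + a (i + 2) + ⋯` of a probability mass function `a`. -/
noncomputable def tail (a : ℕ → ℝ) (i : ℕ) : ℝ :=
  1 - ∑ b ∈ Finset.range (i + 1), a b

section Tail

variable {a : ℕ → ℝ}

theorem hasSum_tail (hsum : HasSum a 1) (i : ℕ) :
    HasSum (fun b => if i < b then a b else 0) (tail a i) := by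
  have h : HasSum (fun b => a b - if b < i + 1 then a b else 0) (tail a i) := by
    refine hsum.sub ?_
    have : HasSum (fun b => if b < i + 1 then a b else 0)
        (∑ b ∈ Finset.range (i + 1), if b < i + 1 then a b else 0) :=
      hasSum_sum_of_ne_finset_zero fun b hb => if_neg (by simpa using hb)
    rwa [Finset.sum_congr rfl fun b hb => if_pos (Finset.mem_range.mp hb)] at this
  refine hasSum_of_forall_eq h fun b => ?_
  split_ifs <;> first | omega | simp

theorem tail_nonneg (ha : ∀ b, 0 ≤ a b) (hsum : HasSum a 1) (i : ℕ) : 0 ≤ tail a i :=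
  (hasSum_tail hsum i).nonneg fun b => by split_ifs <;> simp [ha]

theorem tail_pos (ha : ∀ b, 0 < a b) (hsum : HasSum a 1) (i : ℕ) : 0 < tail a i := by
  refine (ha (i + 1)).trans_le ?_
  have := le_hasSum (hasSum_tail hsum i) (i + 1) fun b _ => by split_ifs <;> simp [(ha b).le]
  simpa using this

theorem tail_le_one (ha : ∀ b, 0 ≤ a b) (i : ℕ) : tail a i ≤ 1 := by
  have := Finset.sum_nonneg fun b (_ : b ∈ Finset.range (i + 1)) => ha b
  unfold tail
  linarith

/-- Tonelli on $\{j < b\}$: the mean of $\sum_{j<B} g_j$ is $\sum_j P(B > j)\, g_j$. The choices of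
`g` used below yield the mean, the generating function of the tails, the mean number of services and
the mean number of losses. -/
theorem hasSum_tail_mul (ha : ∀ b, 0 ≤ a b) (hsum : HasSum a 1) {g : ℕ → ℝ} (hg : ∀ i, 0 ≤ g i)
    {s : ℝ} (h : HasSum (fun b => a b * ∑ j ∈ Finset.range b, g j) s) :
    HasSum (fun i => tail a i * g i) s := by
  obtain ⟨F, hF⟩ : ∃ F : ℕ × ℕ → ℝ, ∀ b j, F (b, j) = if j < b then a b * g j else 0 :=
    ⟨fun q => if q.2 < q.1 then a q.1 * g q.2 else 0, fun _ _ => rfl⟩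
  have hF0 : 0 ≤ F := fun q => by
    rw [← Prod.mk.eta (p := q), hF]
    show 0 ≤ _
    split_ifs
    exacts [mul_nonneg (ha _) (hg _), le_rfl]
  have hrow : ∀ b, HasSum (fun j => F (b, j)) (a b * ∑ j ∈ Finset.range b, g j) := by
    intro b
    have : HasSum (fun j => F (b, j)) (∑ j ∈ Finset.range b, F (b, j)) :=
      hasSum_sum_of_ne_finset_zero fun j hj => by rw [hF, if_neg (by simpa using hj)]
    rwa [Finset.sum_congr rfl fun j hj => (hF b j).trans (if_pos (Finset.mem_range.mp hj)),
      ← Finset.mul_sum] at this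
  have hcol : ∀ j, HasSum (fun b => F (b, j)) (tail a j * g j) := by
    intro j
    refine hasSum_of_forall_eq ((hasSum_tail hsum j).mul_right (g j)) fun b => ?_
    rw [hF]
    split_ifs <;> simp
  have hFs : Summable F := by
    rw [summable_prod_of_nonneg hF0]
    refine ⟨fun b => (hrow b).summable, ?_⟩
    simpa only [(hrow _).tsum_eq] using h.summable
  have h1 := hFs.hasSum
  have h2 : HasSum (fun b => a b * ∑ j ∈ Finset.range b, g j) (∑' q, F q) := h1.prod_fiberwise hrow
  have h3 : HasSum (fun q : ℕ × ℕ => F q.swap) (∑' q, F q) :=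
    (Equiv.prodComm ℕ ℕ).hasSum_iff.mpr h1
  rw [h.unique h2]
  exact HasSum.prod_fiberwise (f := fun q : ℕ × ℕ => F q.swap) h3 hcol

theorem hasSum_tail_mean (ha : ∀ b, 0 ≤ a b) (hsum : HasSum a 1) {m : ℝ}
    (hm : HasSum (fun b : ℕ => (b : ℝ) * a b) m) : HasSum (tail a) m := by
  have := hasSum_tail_mul ha hsum (g := fun _ => 1) (fun _ => zero_le_one) (s := m)
    (by simpa [mul_comm] using hm)
  simpa using this

theorem hasSum_tail_mul_pow (ha : ∀ b, 0 ≤ a b) (hsum : HasSum a 1) {u A : ℝ} (hu0 : 0 ≤ u)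
    (hu1 : u < 1) (hA : HasSum (fun b : ℕ => u ^ b * a b) A) :
    HasSum (fun i => tail a i * u ^ i) ((1 - A) / (1 - u)) := by
  refine hasSum_tail_mul ha hsum (fun i => pow_nonneg hu0 i) ?_
  have := (hsum.sub hA).div_const (1 - u)
  refine hasSum_of_forall_eq this fun b => ?_
  rw [geom_sum_eq hu1.ne]
  have h1 : u - 1 ≠ 0 := by linarith
  have h2 : 1 - u ≠ 0 := by linarith
  field_simp
  ring

/-- The generating function of the tails. -/
noncomputable def tailGen (a : ℕ → ℝ) (u : ℝ) : ℝ := ∑' i, tail a i * u ^ i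

/-- If the mean of `a` exceeds `1`, then the generating function of the tails of `a` takes the
value `1` exactly once in `(0, 1)`. -/
theorem existsUnique_tailGen_eq_one (ha : ∀ b, 0 < a b) (hsum : HasSum a 1) {m : ℝ}
    (hm : HasSum (fun b : ℕ => (b : ℝ) * a b) m) (hm1 : 1 < m) :
    ∃ z ∈ Ioo (0 : ℝ) 1, tailGen a z = 1 ∧ ∀ y ∈ Ioo (0 : ℝ) 1, tailGen a y = 1 → y = z := by
  have ht := hasSum_tail_mean (fun b => (ha b).le) hsum hm
  have ht0 := tail_nonneg (fun b => (ha b).le) hsum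
  have hsm : ∀ u ∈ Icc (0 : ℝ) 1, ∀ i, ‖tail a i * u ^ i‖ ≤ tail a i := by
    intro u hu i
    rw [Real.norm_eq_abs, abs_of_nonneg (mul_nonneg (ht0 i) (pow_nonneg hu.1 i))]
    exact mul_le_of_le_one_right (ht0 i) (pow_le_one₀ hu.1 hu.2)
  have hcont : ContinuousOn (tailGen a) (Icc 0 1) :=
    continuousOn_tsum (fun i => by fun_prop) ht.summable fun i u hu => hsm u hu i
  have h0 : tailGen a 0 < 1 := by
    rw [tailGen, tsum_eq_single 0 (fun i hi => by simp [hi])]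
    simp [tail, ha 0]
  have h1 : tailGen a 1 = m := by simpa [tailGen] using ht.tsum_eq
  have hmono : ∀ x ∈ Ioo (0 : ℝ) 1, ∀ y ∈ Ioo (0 : ℝ) 1, x < y → tailGen a x < tailGen a y := by
    intro x hx y hy hxy
    refine Summable.tsum_lt_tsum (i := 1) (fun i => ?_) ?_ ?_ ?_
    · exact mul_le_mul_of_nonneg_left (pow_le_pow_left₀ hx.1.le hxy.le i) (ht0 i)
    · simpa using mul_lt_mul_of_pos_left hxy (tail_pos ha hsum 1)
    · exact Summable.of_norm_bounded ht.summable (hsm x ⟨hx.1.le, hx.2.le⟩)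
    · exact Summable.of_norm_bounded ht.summable (hsm y ⟨hy.1.le, hy.2.le⟩)
  obtain ⟨z, hz, hz1⟩ := intermediate_value_Ioo zero_le_one hcont ⟨h0, h1 ▸ hm1⟩
  refine ⟨z, hz, hz1, fun y hy hy1 => ?_⟩
  rcases lt_trichotomy y z with h | h | h
  · exact absurd (hmono y hy z hz h) (by rw [hy1, hz1]; exact lt_irrefl _)
  · exact h
  · exact absurd (hmono z hz y hy h) (by rw [hy1, hz1]; exact lt_irrefl _)

theorem hasDerivAt_tailGen (ha : ∀ b, 0 ≤ a b) (hsum : HasSum a 1) {z : ℝ} (hz : z ∈ Ioo (0 : ℝ) 1) :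
    HasDerivAt (tailGen a) (∑' i : ℕ, tail a i * (i * z ^ (i - 1))) z := by
  -- A radius strictly between `z` and `1` bounds the differentiated terms uniformly on `Ioo 0 r` by
  -- the summable sequence $i r^{i-1}$.
  obtain ⟨r, hzr, hr1⟩ := exists_between hz.2
  have hr0 : 0 < r := hz.1.trans hzr
  have hbd : Summable fun i : ℕ => (i : ℝ) * r ^ (i - 1) := by
    rw [← summable_nat_add_iff 1]
    simp only [Nat.add_sub_cancel]
    have h1 := summable_pow_mul_geometric_of_norm_lt_one 1 (r := r) (by
      rwa [Real.norm_eq_abs, abs_of_pos hr0])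
    have h2 := summable_geometric_of_lt_one hr0.le hr1
    refine (h1.add h2).congr fun i => ?_
    push_cast
    ring
  refine hasDerivAt_tsum_of_isPreconnected (t := Ioo 0 r) hbd isOpen_Ioo isPreconnected_Ioo
    (fun i y _ => (hasDerivAt_pow i y).const_mul _) (fun i y hy => ?_) (y₀ := z) ⟨hz.1, hzr⟩ ?_
    ⟨hz.1, hzr⟩
  · have hy0 := hy.1
    rw [Real.norm_eq_abs, abs_of_nonneg (mul_nonneg (tail_nonneg ha hsum i) (by positivity))]
    refine (mul_le_of_le_one_left (by positivity) (tail_le_one ha i)).trans ?_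
    exact mul_le_mul_of_nonneg_left (pow_le_pow_left₀ hy0.le hy.2.le _) (Nat.cast_nonneg i)
  · refine Summable.of_norm_bounded (summable_geometric_of_lt_one hz.1.le hz.2) fun i => ?_
    have := hz.1
    rw [Real.norm_eq_abs, abs_of_nonneg (mul_nonneg (tail_nonneg ha hsum i) (by positivity))]
    exact mul_le_of_le_one_left (by positivity) (tail_le_one ha i)

theorem summable_natCast_mul_tail_mul_pow (ha : ∀ b, 0 ≤ a b) (hsum : HasSum a 1) {z : ℝ}
    (hz : z ∈ Ioo (0 : ℝ) 1) : Summable fun i : ℕ => (i : ℝ) * (tail a i * z ^ i) := by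
  have h1 := summable_pow_mul_geometric_of_norm_lt_one 1 (r := z) (by
    rw [Real.norm_eq_abs, abs_of_pos hz.1]; exact hz.2)
  refine Summable.of_norm_bounded h1 fun i => ?_
  have := hz.1
  rw [Real.norm_eq_abs, abs_of_nonneg (mul_nonneg (Nat.cast_nonneg i)
    (mul_nonneg (tail_nonneg ha hsum i) (by positivity))), pow_one]
  exact mul_le_mul_of_nonneg_left (mul_le_of_le_one_left (by positivity) (tail_le_one ha i))
    (Nat.cast_nonneg i)

/-- The mean of the distribution with weights `tail a i * z ^ i`, in terms of the derivative of
the generating function `A` of `a`. -/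
theorem one_sub_deriv_gen (ha : ∀ b, 0 ≤ a b) (hsum : HasSum a 1) {A : ℝ → ℝ}
    (hA : ∀ u ∈ Icc (0 : ℝ) 1, HasSum (fun b : ℕ => u ^ b * a b) (A u)) {z : ℝ}
    (hz : z ∈ Ioo (0 : ℝ) 1) (hz1 : tailGen a z = 1) :
    (1 - deriv A z) * z = (1 - z) * ∑' i : ℕ, (i : ℝ) * (tail a i * z ^ i) := by
  have h1 := hasDerivAt_tailGen ha hsum hz
  have h2 : HasDerivAt (fun u => 1 - (1 - u) * tailGen a u)
      (-((-1) * tailGen a z + (1 - z) * ∑' i : ℕ, tail a i * (i * z ^ (i - 1)))) z :=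
    (((hasDerivAt_id z).const_sub 1).mul h1).const_sub 1
  -- Near `z` the relation between `A` and the tails can be inverted, so `A` inherits
  -- differentiability from the power series `tailGen a`.
  have h3 : A =ᶠ[𝓝 z] fun u => 1 - (1 - u) * tailGen a u := by
    filter_upwards [isOpen_Ioo.mem_nhds hz] with u hu
    have h := (hasSum_tail_mul_pow ha hsum hu.1.le hu.2 (hA u ⟨hu.1.le, hu.2.le⟩)).tsum_eq
    rw [tailGen, h, mul_div_cancel₀ _ (by linarith [hu.2])]
    ring
  rw [(h2.congr_of_eventuallyEq h3).deriv, hz1]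
  have h4 : ∑' i : ℕ, (i : ℝ) * (tail a i * z ^ i) =
      z * ∑' i : ℕ, tail a i * (i * z ^ (i - 1)) := by
    rw [← tsum_mul_left]
    refine tsum_congr fun i => ?_
    cases i with
    | zero => simp
    | succ i => simp only [Nat.add_sub_cancel, pow_succ]; ring
  rw [h4]
  ring

end Tail

/-! ### The ladder sequence -/

/-- The expected number of services needed to lower the number of customers by one, as a function
of the number of free places, when the number of arrivals during a service has law `a`. -/
noncomputable def ladder (a : ℕ → ℝ) : ℕ → ℝ
  | 0 => 1
  | n + 1 => (1 + ∑ i : Fin n, tail a (i + 1) * ladder a (n - i)) / a 0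

section Ladder

variable {a : ℕ → ℝ}

theorem ladder_succ (a : ℕ → ℝ) (n : ℕ) :
    ladder a (n + 1) = (1 + ∑ i ∈ Finset.range n, tail a (i + 1) * ladder a (n - i)) / a 0 := by
  rw [ladder, Finset.sum_range fun i => tail a (i + 1) * ladder a (n - i)]

theorem tail_zero (a : ℕ → ℝ) : tail a 0 = 1 - a 0 := by simp [tail]

/-- First-step equation: after one service, descending to the target also undoes each accepted
arrival. The arrival with index `i` occurs with probability `tail a i` and costs a descent with `n -
i` free places. The term `i = 0` contains `ladder a n` itself; solving for it produces the division
by `a 0` in the definition. -/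
theorem ladder_eq (ha : ∀ b, 0 < a b) (n : ℕ) :
    ladder a n = 1 + ∑ i ∈ Finset.range n, tail a i * ladder a (n - i) := by
  cases n with
  | zero => simp [ladder]
  | succ n =>
    have h := ladder_succ a n
    rw [eq_div_iff (ha 0).ne'] at h
    rw [Finset.sum_range_succ', tail_zero, Nat.sub_zero]
    simp only [Nat.add_sub_add_right]
    linarith

theorem ladder_pos (ha : ∀ b, 0 < a b) (hsum : HasSum a 1) (n : ℕ) : 0 < ladder a n := by
  induction n using Nat.strong_induction_on with
  | _ n ih =>
    cases n with
    | zero => simp [ladder]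
    | succ n =>
      rw [ladder_succ]
      refine div_pos ?_ (ha 0)
      have : 0 ≤ ∑ i ∈ Finset.range n, tail a (i + 1) * ladder a (n - i) :=
        Finset.sum_nonneg fun i _ =>
          mul_nonneg (tail_nonneg (fun b => (ha b).le) hsum _) (ih _ (by omega)).le
      linarith

variable {z : ℝ}

/-- The convolution in `ladder_eq` never reaches `ladder a 0`; shifting the index by one turns it
into a complete renewal convolution with forcing term $z^{n+1}$. -/
theorem ladder_mul_pow_eq (ha : ∀ b, 0 < a b) (z : ℝ) (n : ℕ) :
    ladder a (n + 1) * z ^ (n + 1) = z ^ (n + 1) + ∑ i ∈ Finset.range (n + 1),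
      (tail a i * z ^ i) * (ladder a (n - i + 1) * z ^ (n - i + 1)) := by
  rw [ladder_eq ha (n + 1), add_mul, one_mul, Finset.sum_mul]
  congr 1
  refine Finset.sum_congr rfl fun i hi => ?_
  have hi' : i ≤ n := Nat.lt_succ_iff.mp (Finset.mem_range.mp hi)
  rw [show n + 1 - i = n - i + 1 by omega,
    show z ^ (n + 1) = z ^ i * z ^ (n - i + 1) by rw [← pow_add]; congr 1; omega]
  ring

theorem hasSum_tail_mul_pow_one (ha : ∀ b, 0 < a b) (hsum : HasSum a 1)
    (hz : z ∈ Ioo (0 : ℝ) 1) (hz1 : tailGen a z = 1) :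
    HasSum (fun i => tail a i * z ^ i) 1 := by
  rw [← hz1]
  refine Summable.hasSum ?_
  refine Summable.of_norm_bounded (summable_geometric_of_lt_one hz.1.le hz.2) fun i => ?_
  have := hz.1
  have ha' := fun b => (ha b).le
  rw [Real.norm_eq_abs, abs_of_nonneg (mul_nonneg (tail_nonneg ha' hsum i) (by positivity))]
  exact mul_le_of_le_one_left (by positivity) (tail_le_one ha' i)

/-- Supplies the boundedness required by the renewal theorem. Moving the term `i = 0` to the left
leaves the factor `a 0`; the other weights add up to at most `a 0`, so each step of the induction
adds at most $z^{n+1}/a_0$. -/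
theorem ladder_mul_pow_le (ha : ∀ b, 0 < a b) (hsum : HasSum a 1) (hz : z ∈ Ioo (0 : ℝ) 1)
    (hz1 : tailGen a z = 1) (n : ℕ) :
    ladder a (n + 1) * z ^ (n + 1) ≤ (∑ k ∈ Finset.range (n + 1), z ^ (k + 1)) / a 0 := by
  induction n using Nat.strong_induction_on with
  | _ n ih =>
    have ht := tail_nonneg (fun b => (ha b).le) hsum
    have hz0 := hz.1
    have hsplit := ladder_mul_pow_eq ha z n
    rw [Finset.sum_range_succ', tail_zero] at hsplit
    simp only [pow_zero, mul_one, Nat.sub_zero] at hsplit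
    set S := (∑ k ∈ Finset.range n, z ^ (k + 1)) / a 0 with hS
    have hS0 : 0 ≤ S := div_nonneg (Finset.sum_nonneg fun k _ => by positivity) (ha 0).le
    have hterm : ∑ i ∈ Finset.range n, (tail a (i + 1) * z ^ (i + 1)) *
        (ladder a (n - (i + 1) + 1) * z ^ (n - (i + 1) + 1)) ≤
        ∑ i ∈ Finset.range n, (tail a (i + 1) * z ^ (i + 1)) * S := by
      refine Finset.sum_le_sum fun i hi => ?_
      have hi' := Finset.mem_range.mp hi
      refine mul_le_mul_of_nonneg_left ?_ (mul_nonneg (ht _) (by positivity))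
      refine (ih (n - (i + 1)) (by omega)).trans ?_
      refine div_le_div_of_nonneg_right ?_ (ha 0).le
      refine Finset.sum_le_sum_of_subset_of_nonneg ?_ fun k _ _ => by positivity
      exact Finset.range_mono (by omega)
    have hmass : ∑ i ∈ Finset.range n, tail a (i + 1) * z ^ (i + 1) ≤ a 0 := by
      have h := sum_le_hasSum (Finset.range (n + 1))
        (fun i _ => mul_nonneg (ht i) (pow_nonneg hz0.le i)) (hasSum_tail_mul_pow_one ha hsum hz hz1)
      rw [Finset.sum_range_succ', tail_zero] at h
      simp only [pow_zero, mul_one] at h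
      linarith
    rw [← Finset.sum_mul] at hterm
    have hfin : a 0 * S = ∑ k ∈ Finset.range n, z ^ (k + 1) := mul_div_cancel₀ _ (ha 0).ne'
    rw [le_div_iff₀ (ha 0), Finset.sum_range_succ, ← hfin]
    nlinarith [mul_le_mul_of_nonneg_right hmass hS0]

theorem ladder_mul_pow_bounded (ha : ∀ b, 0 < a b) (hsum : HasSum a 1) (hz : z ∈ Ioo (0 : ℝ) 1)
    (hz1 : tailGen a z = 1) : ∃ K, ∀ n, |ladder a n * z ^ n| ≤ K := by
  have hg := summable_geometric_of_lt_one hz.1.le hz.2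
  have hz0 := hz.1
  refine ⟨max 1 ((∑' k, z ^ (k + 1)) / a 0), fun n => ?_⟩
  rw [abs_of_nonneg (mul_nonneg (ladder_pos ha hsum n).le (by positivity))]
  cases n with
  | zero => simp [ladder]
  | succ n =>
    refine ((ladder_mul_pow_le ha hsum hz hz1 n).trans ?_).trans (le_max_right _ _)
    refine div_le_div_of_nonneg_right ?_ (ha 0).le
    exact Summable.sum_le_tsum _ (fun k _ => by positivity) ((summable_nat_add_iff 1).mpr hg)

theorem tendsto_ladder_mul_pow (ha : ∀ b, 0 < a b) (hsum : HasSum a 1) (hz : z ∈ Ioo (0 : ℝ) 1)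
    (hz1 : tailGen a z = 1) :
    Tendsto (fun n => ladder a n * z ^ n) atTop
      (𝓝 (z / (1 - z) / ∑' i : ℕ, (i : ℝ) * (tail a i * z ^ i))) := by
  rw [← tendsto_add_atTop_iff_nat 1]
  obtain ⟨K, hK⟩ := ladder_mul_pow_bounded ha hsum hz hz1
  have hz0 := hz.1
  have ht := tail_pos ha hsum
  have hs1 := hasSum_tail_mul_pow_one ha hsum hz hz1
  have hs2 := summable_natCast_mul_tail_mul_pow (fun b => (ha b).le) hsum hz
  have hg : HasSum (fun n => z ^ (n + 1)) (z / (1 - z)) := by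
    have := (hasSum_geometric_of_lt_one hz.1.le hz.2).mul_left z
    rw [← div_eq_mul_inv] at this
    exact hasSum_of_forall_eq this fun n => (pow_succ' z n).symm
  have h := tendsto_renewal (ι := Unit) (p := fun _ i => tail a i * z ^ i) (nxt := fun _ _ => ())
    (w := fun _ => 1) (l := fun n _ => ladder a (n + 1) * z ^ (n + 1))
    (c := fun n _ => z ^ (n + 1)) (K := K)
    (fun _ b => mul_pos (ht b) (by positivity)) (fun _ => hs1) (fun _ => hs2)
    (fun g => by simp [tsum_mul_right, hs1.tsum_eq]) ?_ ?_ (fun n _ => hK _)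
    (fun _ => hg.summable) (fun n _ => ladder_mul_pow_eq ha z n) ()
  · simpa [hg.tsum_eq] using h
  · simp only [Finset.univ_unique, one_mul, Finset.sum_singleton]
    refine hs2.tsum_pos (fun i => ?_) 1 ?_
    · exact mul_nonneg (Nat.cast_nonneg i) (mul_nonneg (ht i).le (by positivity))
    · exact mul_pos (by norm_num) (mul_pos (ht 1) (by positivity))
  · rintro T ⟨_, h0⟩ hT
    refine ⟨0, fun i _ _ => ?_⟩
    have := hT 0 () i h0
    rwa [zero_add] at this

end Ladder

/-! ### The expected number of services in a cycle -/

/-- The expected number of services between two returns to the empty system of capacity `N`, when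
the numbers of arrivals during a service and during a vacation have the laws `a` and `v`. -/
noncomputable def cycleServices (a v : ℕ → ℝ) (N : ℕ) : ℝ :=
  ∑ i ∈ Finset.range N, tail v i * ladder a (N - 1 - i)

theorem cycleServices_pos {a v : ℕ → ℝ} (ha : ∀ b, 0 < a b) (hsum : HasSum a 1)
    (hv : ∀ b, 0 < v b) (hvsum : HasSum v 1) {N : ℕ} (hN : 1 ≤ N) : 0 < cycleServices a v N :=
  Finset.sum_pos (fun i _ => mul_pos (tail_pos hv hvsum i) (ladder_pos ha hsum _))
    ⟨0, Finset.mem_range.mpr hN⟩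

/-- Distributing $z^N = z \cdot z^i \cdot z^{N-1-i}$ over the convolution, dominated convergence
replaces each $h_{N-1-i} z^{N-1-i}$ by its limit and leaves `tailGen v z`. -/
theorem tendsto_cycleServices {a v : ℕ → ℝ} (ha : ∀ b, 0 < a b) (hsum : HasSum a 1)
    (hv : ∀ b, 0 < v b) (hvsum : HasSum v 1) {z : ℝ} (hz : z ∈ Ioo (0 : ℝ) 1)
    (hz1 : tailGen a z = 1) :
    Tendsto (fun N => z ^ N * cycleServices a v N) atTop
      (𝓝 (z * tailGen v z * (z / (1 - z) / ∑' i : ℕ, (i : ℝ) * (tail a i * z ^ i)))) := by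
  set u := z / (1 - z) / ∑' i : ℕ, (i : ℝ) * (tail a i * z ^ i) with hu
  obtain ⟨K, hK⟩ := ladder_mul_pow_bounded ha hsum hz hz1
  have hlim := tendsto_ladder_mul_pow ha hsum hz hz1
  have hz0 := hz.1
  have hv' := fun b => (hv b).le
  have hrw : ∀ N, z ^ N * cycleServices a v N =
      ∑' i, z * (tail v i * z ^ i) *
        (if i < N then ladder a (N - 1 - i) * z ^ (N - 1 - i) else 0) := by
    intro N
    rw [tsum_eq_sum (s := Finset.range N) fun i hi => by
      rw [if_neg (by simpa using hi), mul_zero], cycleServices, Finset.mul_sum]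
    refine Finset.sum_congr rfl fun i hi => ?_
    have hi' := Finset.mem_range.mp hi
    rw [if_pos hi', show z ^ N = z * z ^ i * z ^ (N - 1 - i) by
      rw [mul_assoc, ← pow_add, ← pow_succ']; congr 1; omega]
    ring
  have hfin : z * tailGen v z * u = ∑' i, z * (tail v i * z ^ i) * u := by
    rw [tsum_mul_right, tsum_mul_left]
    rfl
  rw [hfin]
  simp only [hrw]
  refine tendsto_tsum_of_dominated_convergence (bound := fun i => z * z ^ i * K)
    (((summable_geometric_of_lt_one hz.1.le hz.2).mul_left z).mul_right K) (fun i => ?_)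
    (Eventually.of_forall fun N i => ?_)
  · refine Tendsto.const_mul _ ?_
    have h1 : Tendsto (fun N => N - 1 - i) atTop atTop :=
      (tendsto_sub_atTop_nat i).comp (tendsto_sub_atTop_nat 1)
    refine (hlim.comp h1).congr' ?_
    filter_upwards [eventually_gt_atTop i] with N hN
    rw [if_pos hN, Function.comp_apply]
  · have hK0 : 0 ≤ K := (abs_nonneg _).trans (hK 0)
    have h0 := tail_nonneg hv' hvsum i
    rw [Real.norm_eq_abs, abs_mul, abs_of_nonneg (by positivity)]
    refine mul_le_mul ?_ ?_ (abs_nonneg _) (by positivity)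
    · refine mul_le_mul_of_nonneg_left ?_ hz0.le
      exact mul_le_of_le_one_left (by positivity) (tail_le_one hv' i)
    · split_ifs
      · exact hK _
      · simpa using hK0

/-! ### The embedded chain -/

/-- The number of customers at the beginning of the next activity. -/
def step (N x b : ℕ) : ℕ := if x = 0 then min (x + b) N else min (x + b) N - 1

theorem step_le (N x b : ℕ) : step N x b ≤ N := by
  unfold step
  split_ifs <;> omega

/-- The law of the number of arrivals during an activity that begins with `x` customers. -/
def activityLaw (a v : ℕ → ℝ) (x : ℕ) : ℕ → ℝ := if x = 0 then v else a

/-- The probability that customer `n` arrives and is lost during the current activity, which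
begins with `x` customers in a system of capacity `N`. -/
noncomputable def lossNow (a v : ℕ → ℝ) (N n x : ℕ) : ℝ :=
  if N ≤ x + n then tail (activityLaw a v x) n else 0

theorem exists_stationary_kernel {ι : Type*} [Fintype ι] [Nonempty ι] {p : ι → ℕ → ℝ}
    (nxt : ι → ℕ → ι) (hp : ∀ x b, 0 ≤ p x b) (hsum : ∀ x, HasSum (p x) 1) :
    ∃ w : ι → ℝ, (∀ x, 0 ≤ w x) ∧ ∑ x, w x = 1 ∧
      ∀ g : ι → ℝ, ∑ x, w x * ∑' b, p x b * g (nxt x b) = ∑ x, w x * g x := by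
  classical
  have hs : ∀ x y, Summable fun b => p x b * if nxt x b = y then (1 : ℝ) else 0 := fun x y =>
    summable_mul_of_abs_le (K := 1) (hp x) (hsum x).summable fun b => by split_ifs <;> simp
  obtain ⟨w, hw0, hw1, hw⟩ := exists_stationary
    (fun x y => ∑' b, p x b * if nxt x b = y then (1 : ℝ) else 0)
    (fun x y => tsum_nonneg fun b => mul_nonneg (hp x b) (by split_ifs <;> simp))
    (fun x => by
      rw [← Summable.tsum_finsetSum fun y _ => hs x y]
      exact (tsum_congr fun b => by simp).trans (hsum x).tsum_eq)
  refine ⟨w, hw0, hw1, fun g => ?_⟩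
  have key : ∀ x, ∑' b, p x b * g (nxt x b) =
      ∑ y, (∑' b, p x b * if nxt x b = y then (1 : ℝ) else 0) * g y := by
    intro x
    simp only [← tsum_mul_right]
    rw [← Summable.tsum_finsetSum fun y _ => (hs x y).mul_right _]
    exact tsum_congr fun b => by simp
  simp only [key, Finset.mul_sum]
  rw [Finset.sum_comm]
  refine Finset.sum_congr rfl fun y _ => ?_
  rw [← hw y, Finset.sum_mul]
  exact Finset.sum_congr rfl fun x _ => by ring

/-- The expected number of services until the system is empty, if it now holds `x` customers and
a service is about to begin. -/
noncomputable def descent (a : ℕ → ℝ) (N x : ℕ) : ℝ :=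
  ∑ y ∈ Finset.range x, ladder a (N - 1 - y)

section Chain

variable {a v : ℕ → ℝ} {N : ℕ}

theorem abs_descent_le (ha : ∀ b, 0 < a b) (hsum : HasSum a 1) {x : ℕ} (hx : x ≤ N) :
    |descent a N x| ≤ descent a N N := by
  unfold descent
  rw [abs_of_nonneg (Finset.sum_nonneg fun _ _ => (ladder_pos ha hsum _).le)]
  exact Finset.sum_le_sum_of_subset_of_nonneg (Finset.range_mono hx)
    fun _ _ _ => (ladder_pos ha hsum _).le

theorem descent_min (a : ℕ → ℝ) (N b : ℕ) : descent a N (min b N) =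
    ∑ j ∈ Finset.range b, if j < N then ladder a (N - 1 - j) else 0 := by
  rw [descent, ← Finset.sum_filter]
  refine Finset.sum_congr ?_ fun _ _ => rfl
  ext j
  simp

theorem descent_step {x : ℕ} (hx0 : x ≠ 0) (hx : x ≤ N) (b : ℕ) : descent a N (step N x b) =
    descent a N (x - 1) + ∑ j ∈ Finset.range b, if x + j < N then ladder a (N - x - j) else 0 := by
  rw [step, if_neg hx0]
  induction b with
  | zero => simp [min_eq_left hx]
  | succ b ih =>
    rw [Finset.sum_range_succ, ← add_assoc (descent _ _ _), ← ih]
    by_cases h : x + b < N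
    · rw [if_pos h, min_eq_left (by omega), min_eq_left (by omega),
        show x + (b + 1) - 1 = x + b - 1 + 1 by omega, descent, Finset.sum_range_succ, descent,
        show N - 1 - (x + b - 1) = N - x - b by omega]
    · rw [if_neg h, min_eq_right (by omega), min_eq_right (by omega), add_zero]

theorem tsum_descent_zero (ha : ∀ b, 0 < a b) (hsum : HasSum a 1)
    (hv : ∀ b, 0 < v b) (hvsum : HasSum v 1) :
    ∑' b, v b * descent a N (step N 0 b) = cycleServices a v N := by
  set g : ℕ → ℝ := fun j => if j < N then ladder a (N - 1 - j) else 0 with hg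
  have hv' := fun b => (hv b).le
  have hst : ∀ b, descent a N (step N 0 b) = ∑ j ∈ Finset.range b, g j := by
    intro b
    rw [step, if_pos rfl, zero_add, descent_min]
  have hg0 : ∀ j, 0 ≤ g j := fun j => by
    simp only [hg]
    split_ifs
    exacts [(ladder_pos ha hsum _).le, le_rfl]
  have hbd : ∀ b, |descent a N (step N 0 b)| ≤ descent a N N :=
    fun b => abs_descent_le ha hsum (step_le _ _ _)
  have hs := (summable_mul_of_abs_le hv' hvsum.summable hbd).hasSum
  have h2 := hasSum_tail_mul hv' hvsum hg0 (hasSum_of_forall_eq hs fun b => by rw [hst])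
  rw [← h2.tsum_eq, tsum_eq_sum (s := Finset.range N) fun i hi => by
    simp only [hg]; rw [if_neg (by simpa using hi), mul_zero], cycleServices]
  refine Finset.sum_congr rfl fun i hi => ?_
  simp only [hg]
  rw [if_pos (Finset.mem_range.mp hi)]

/-- A service has drift $-1$ for the remaining mean number of services: it is the first-step
equation `ladder_eq` at `N - x` free places, written for the whole descent to the empty system. -/
theorem tsum_descent_step (ha : ∀ b, 0 < a b) (hsum : HasSum a 1) {x : ℕ} (hx0 : x ≠ 0)
    (hx : x ≤ N) : ∑' b, a b * descent a N (step N x b) = descent a N x - 1 := by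
  set g : ℕ → ℝ := fun j => if x + j < N then ladder a (N - x - j) else 0 with hg
  have ha' := fun b => (ha b).le
  have hg0 : ∀ j, 0 ≤ g j := fun j => by
    simp only [hg]
    split_ifs
    exacts [(ladder_pos ha hsum _).le, le_rfl]
  have hbd : ∀ b, |descent a N (step N x b)| ≤ descent a N N :=
    fun b => abs_descent_le ha hsum (step_le _ _ _)
  have hs := (summable_mul_of_abs_le ha' hsum.summable hbd).hasSum
  have h1 := hs.sub (hsum.mul_right (descent a N (x - 1)))
  have h2 := hasSum_tail_mul ha' hsum hg0 (hasSum_of_forall_eq h1 fun b => by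
    rw [descent_step hx0 hx, ← mul_sub, add_sub_cancel_left])
  have h3 : ∑' i, tail a i * g i = ∑ i ∈ Finset.range (N - x), tail a i * ladder a (N - x - i) := by
    rw [tsum_eq_sum (s := Finset.range (N - x)) fun i hi => by
      simp only [hg]; rw [if_neg (by simp at hi; omega), mul_zero]]
    refine Finset.sum_congr rfl fun i hi => ?_
    have := Finset.mem_range.mp hi
    simp only [hg]
    rw [if_pos (by omega)]
  have h4 := ladder_eq ha (N - x)
  have h5 : descent a N x = descent a N (x - 1) + ladder a (N - x) := by
    obtain ⟨y, rfl⟩ := Nat.exists_eq_succ_of_ne_zero hx0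
    rw [descent, Finset.sum_range_succ, Nat.succ_sub_one, descent,
      show N - 1 - y = N - y.succ by omega]
  rw [h2.tsum_eq] at h3
  linarith

/-- Conservation of customers during one activity: the lost ones are the initial ones plus the
arrivals, minus the departure at the end of a service, minus those left. -/
theorem sum_full (hN : 1 ≤ N) {x : ℕ} (hx : x ≤ N) (b : ℕ) :
    ∑ j ∈ Finset.range b, (if N ≤ x + j then (1 : ℝ) else 0) =
      x + b - (if x = 0 then 0 else 1) - step N x b := by
  have key : ∀ b : ℕ, ∑ j ∈ Finset.range b, (if N ≤ x + j then (1 : ℝ) else 0) =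
      x + b - (min (x + b) N : ℕ) := by
    intro b
    induction b with
    | zero => simp [hx]
    | succ b ih =>
      rw [Finset.sum_range_succ, ih]
      split_ifs with h
      · rw [min_eq_right h, min_eq_right (by omega)]
        push_cast
        ring
      · rw [min_eq_left (by omega), min_eq_left (by omega)]
        push_cast
        ring
  rw [key, step]
  split_ifs with h
  · simp
  · rw [Nat.cast_sub (by omega)]
    push_cast
    ring

/-- Under the stationary law the initial and final queue lengths of an activity cancel in
`sum_full`, so the mean loss is mean arrivals minus the fraction of services. That fraction comes
from testing stationarity on `descent`. -/
theorem tendsto_loss (ha : ∀ b, 0 < a b) (hsum : HasSum a 1) (hv : ∀ b, 0 < v b)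
    (hvsum : HasSum v 1) {ma mv : ℝ} (hma : HasSum (fun b : ℕ => (b : ℝ) * a b) ma)
    (hmv : HasSum (fun b : ℕ => (b : ℝ) * v b) mv) (hN : 1 ≤ N) {l : ℕ → ℕ → ℝ} {K : ℝ}
    (hl : ∀ n x, x ≤ N → |l n x| ≤ K)
    (heq : ∀ n x, x ≤ N → l n x = lossNow a v N n x +
      ∑ b ∈ Finset.range (n + 1), activityLaw a v x b * l (n - b) (step N x b)) :
    Tendsto (fun n => l n 0) atTop
      (𝓝 (1 - cycleServices a v N / (mv + cycleServices a v N * ma))) := by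
  have hp : ∀ x b, 0 < activityLaw a v x b := by
    intro x b
    unfold activityLaw
    split_ifs
    exacts [hv b, ha b]
  have hps : ∀ x, HasSum (activityLaw a v x) 1 := by
    intro x
    unfold activityLaw
    split_ifs
    exacts [hvsum, hsum]
  have hpm : ∀ x, HasSum (fun b : ℕ => (b : ℝ) * activityLaw a v x b)
      (if x = 0 then mv else ma) := by
    intro x
    unfold activityLaw
    split_ifs
    exacts [hmv, hma]
  have hma0 : 0 < ma := by
    have h := le_hasSum hma 1 fun j _ => mul_nonneg (Nat.cast_nonneg j) (ha j).le
    have := ha 1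
    simp only [Nat.cast_one, one_mul] at h
    linarith
  have hmv0 : 0 < mv := by
    have h := le_hasSum hmv 1 fun j _ => mul_nonneg (Nat.cast_nonneg j) (hv j).le
    have := hv 1
    simp only [Nat.cast_one, one_mul] at h
    linarith
  have hEK := cycleServices_pos ha hsum hv hvsum hN
  set EK := cycleServices a v N with hEKdef
  let nxt : Fin (N + 1) → ℕ → Fin (N + 1) := fun x b =>
    ⟨step N x b, Nat.lt_succ_of_le (step_le N x b)⟩
  obtain ⟨w, hw0, hw1, hw⟩ := exists_stationary_kernel
    (p := fun x : Fin (N + 1) => activityLaw a v x) nxt (fun x b => (hp x b).le) (fun x => hps x)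
  have hrest : ∑ i : Fin N, w i.succ = 1 - w 0 := by
    rw [Fin.sum_univ_succ] at hw1
    linarith
  have hone : ∑ x : Fin (N + 1), w x * (if (x : ℕ) = 0 then 0 else 1) = 1 - w 0 := by
    rw [Fin.sum_univ_succ]
    simp [hrest]
  have hmean : ∑ x : Fin (N + 1), w x * ∑' b : ℕ, (b : ℝ) * activityLaw a v x b =
      w 0 * mv + (1 - w 0) * ma := by
    simp only [(hpm _).tsum_eq]
    rw [Fin.sum_univ_succ, ← hrest]
    simp [Finset.sum_mul]
  -- The drift of `descent` is $-1$ at every service and `EK` at a vacation; its stationary mean is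
  -- zero.
  have hbal : 1 - w 0 = w 0 * EK := by
    have h1 := hw fun x => descent a N x
    have h2 : ∀ x : Fin (N + 1), ∑' b, activityLaw a v x b * descent a N (nxt x b) =
        descent a N x - (if (x : ℕ) = 0 then 0 else 1) + (if (x : ℕ) = 0 then EK else 0) := by
      intro x
      by_cases hx : (x : ℕ) = 0
      · simp only [nxt, hx, if_true, activityLaw]
        rw [tsum_descent_zero ha hsum hv hvsum]
        simp [descent, hEKdef]
      · simp only [nxt, hx, if_false, activityLaw]
        rw [tsum_descent_step ha hsum hx (Nat.lt_succ_iff.mp x.2), add_zero]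
    simp only [h2, mul_add, mul_sub, Finset.sum_add_distrib, Finset.sum_sub_distrib, hone] at h1
    have h3 : ∑ x : Fin (N + 1), w x * (if (x : ℕ) = 0 then EK else 0) = w 0 * EK := by
      rw [Fin.sum_univ_succ]
      simp
    linarith
  have hcsum : ∀ x : Fin (N + 1), HasSum (fun n => lossNow a v N n x)
      (x + (if (x : ℕ) = 0 then mv else ma) - (if (x : ℕ) = 0 then 0 else 1) -
        ∑' b, activityLaw a v x b * (nxt x b : ℕ)) := by
    intro x
    have hx := Nat.lt_succ_iff.mp x.2
    have h1 : Summable fun b => activityLaw a v x b * ((nxt x b : ℕ) : ℝ) := by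
      refine summable_mul_of_abs_le (K := N) (fun b => (hp _ b).le) (hps x).summable fun b => ?_
      rw [Nat.abs_cast]
      exact Nat.cast_le.mpr (step_le _ _ _)
    have h2 := (((hps x).mul_right (x : ℝ)).add (hpm x)).sub
      ((hps x).mul_right (if (x : ℕ) = 0 then (0 : ℝ) else 1))
    have h3 := h2.sub h1.hasSum
    rw [one_mul, one_mul] at h3
    have h4 := hasSum_tail_mul (fun b => (hp x b).le) (hps x)
      (g := fun j => if N ≤ x + j then (1 : ℝ) else 0) (fun j => by split_ifs <;> simp)
      (hasSum_of_forall_eq h3 fun b => by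
        rw [sum_full hN hx]
        simp only [nxt]
        ring)
    refine hasSum_of_forall_eq h4 fun n => ?_
    simp [lossNow]
  have hloss : ∑ x, w x * ∑' n, lossNow a v N n x = w 0 * mv + (1 - w 0) * ma - (1 - w 0) := by
    simp only [(hcsum _).tsum_eq, mul_add, mul_sub, Finset.sum_add_distrib, Finset.sum_sub_distrib]
    rw [hone, hw fun x => ((x : ℕ) : ℝ), ← hmean]
    simp only [(hpm _).tsum_eq]
    ring
  have hw0pos : 0 < w 0 := by
    refine (hw0 0).lt_of_ne fun h => ?_
    rw [← h] at hbal
    norm_num at hbal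
  have hpos : 0 < w 0 * mv + (1 - w 0) * ma := by
    rw [hbal]
    positivity
  have h := tendsto_renewal (p := fun x : Fin (N + 1) => activityLaw a v x) (nxt := nxt) (w := w)
    (l := fun n x => l n x) (c := fun n x => lossNow a v N n x) (K := K) (fun x b => hp x b)
    (fun x => hps x) (fun x => (hpm x).summable) hw (by rw [hmean]; exact hpos) ?_
    (fun n x => hl n x (Nat.lt_succ_iff.mp x.2)) (fun x => (hcsum x).summable)
    (fun n x => heq n x (Nat.lt_succ_iff.mp x.2)) 0
  · rw [hloss, hmean] at h
    simp only [Fin.val_zero] at h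
    convert h using 2
    rw [hbal]
    have : mv + EK * ma ≠ 0 := by positivity
    have := hw0pos.ne'
    have : w 0 * mv + w 0 * EK * ma ≠ 0 := by positivity
    field_simp
  -- A service without arrivals lowers the state by one and leaves the customer index fixed, so all
  -- lower states are reached at the same index. From the empty state, a vacation with `i ≥ N`
  -- arrivals fills the system at index `i`; hence $i_0 = N$ suffices.
  · rintro T ⟨x, hx⟩ hT
    have hdesc : ∀ i (k : ℕ) (hk : k < N + 1), T i ⟨k, hk⟩ → ∀ y : Fin (N + 1), (y : ℕ) ≤ k →
        T i y := by
      intro i k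
      induction k with
      | zero =>
        intro hk h y hy
        rwa [show y = ⟨0, hk⟩ from Fin.ext (by simpa using hy)]
      | succ k ih =>
        intro hk h y hy
        rcases Nat.lt_or_ge k y with hlt | hge
        · rwa [show y = ⟨k + 1, hk⟩ from Fin.ext (by simp; omega)]
        · refine ih (by omega) ?_ y hge
          have h1 := hT i _ 0 h
          rw [add_zero] at h1
          convert h1 using 1
          refine Fin.ext ?_
          simp only [nxt, step]
          rw [if_neg (by omega)]
          omega
    have h0 : T 0 0 := hdesc 0 x x.2 hx 0 (by simp)
    refine ⟨N, fun i hi y => ?_⟩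
    have h1 := hT 0 0 i h0
    rw [zero_add] at h1
    refine hdesc i N (Nat.lt_succ_self N) ?_ y (Nat.lt_succ_iff.mp y.2)
    convert h1 using 1
    refine Fin.ext ?_
    simp only [nxt, step, Fin.val_zero]
    simp [hi]

end Chain

/-! ### Arrival counts along a realisation -/

/-- The number of customers at the beginning of activity `k`, if `b i` customers arrive during
activity `i`. -/
def level (N : ℕ) (b : ℕ → ℕ) : ℕ → ℕ
  | 0 => 0
  | i + 1 => step N (level N b i) (b i)

/-- The duration of activity `i`, if `b j` customers arrive during activity `j`. -/
noncomputable def duration (N : ℕ) (b : ℕ → ℕ) (S V : ℕ → ℝ) (i : ℕ) : ℝ :=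
  if level N b i = 0 then V i else S i

/-- The number of customers who arrive during activity `k`. -/
noncomputable def arrivalsDuring (N : ℕ) (σ S V : ℕ → ℝ) (k : ℕ) : ℕ :=
  arrivalCount σ (activityStart N σ S V (k + 1)).2 - arrivalCount σ (activityStart N σ S V k).2

theorem level_le (N : ℕ) (b : ℕ → ℕ) (k : ℕ) : level N b k ≤ N := by
  cases k with
  | zero => exact Nat.zero_le N
  | succ k => exact step_le _ _ _

theorem level_congr {N : ℕ} {b b' : ℕ → ℕ} {k : ℕ} (h : ∀ i < k, b i = b' i) :
    level N b k = level N b' k := by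
  induction k with
  | zero => rfl
  | succ k ih =>
    rw [level, level, ih fun i hi => h i (by omega), h k (by omega)]

theorem sum_duration_congr {N : ℕ} {b b' : ℕ → ℕ} {S V : ℕ → ℝ} {k : ℕ}
    (h : ∀ i < k, b i = b' i) {j : ℕ} (hj : j ≤ k + 1) :
    ∑ i ∈ Finset.range j, duration N b S V i = ∑ i ∈ Finset.range j, duration N b' S V i := by
  refine Finset.sum_congr rfl fun i hi => ?_
  have hi' := Finset.mem_range.mp hi
  rw [duration, duration, level_congr fun m hm => h m (by omega)]

theorem activityStart_eq (N : ℕ) (σ S V : ℕ → ℝ) (k : ℕ) : activityStart N σ S V k =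
    (level N (arrivalsDuring N σ S V) k,
      ∑ i ∈ Finset.range k, duration N (arrivalsDuring N σ S V) S V i) := by
  induction k with
  | zero => rfl
  | succ k ih =>
    have h2 : (activityStart N σ S V (k + 1)).2 =
        (activityStart N σ S V k).2 + duration N (arrivalsDuring N σ S V) S V k := by
      rw [activityStart, ih]
      rfl
    refine Prod.ext ?_ ?_
    · rw [level, step, arrivalsDuring, h2, activityStart, ih]
      rfl
    · rw [h2, Finset.sum_range_succ, ih]

/-- Activity epochs depend on the arrivals, but only through the earlier counts. Once these are
prescribed, the kind of each activity is known, and the event concerns increments of the arrival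
process over intervals whose endpoints depend on `S` and `V` alone. -/
theorem arrivalsDuring_eq_iff (N : ℕ) (σ S V : ℕ → ℝ) (b : ℕ → ℕ) (k : ℕ) :
    (∀ i < k, arrivalsDuring N σ S V i = b i) ↔
      ∀ i < k, arrivalCount σ (∑ j ∈ Finset.range (i + 1), duration N b S V j) -
        arrivalCount σ (∑ j ∈ Finset.range i, duration N b S V j) = b i := by
  have key : ∀ i, (∀ j < i, arrivalsDuring N σ S V j = b j) → arrivalsDuring N σ S V i =
      arrivalCount σ (∑ j ∈ Finset.range (i + 1), duration N b S V j) -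
        arrivalCount σ (∑ j ∈ Finset.range i, duration N b S V j) := by
    intro i hi
    rw [← sum_duration_congr hi le_rfl, ← sum_duration_congr hi (Nat.le_succ i)]
    rw [arrivalsDuring, activityStart_eq, activityStart_eq]
  induction k with
  | zero => simp
  | succ k ih =>
    simp only [Nat.lt_succ_iff_lt_or_eq, or_imp, forall_and, forall_eq]
    exact ⟨fun h => ⟨ih.mp h.1, (key k h.1).symm.trans h.2⟩,
      fun h => ⟨ih.mpr h.1, (key k (ih.mpr h.1)).trans h.2⟩⟩

theorem measurable_arrivalCount :
    Measurable fun q : (ℕ → ℝ) × ℝ => arrivalCount q.1 q.2 := by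
  have h1 : Measurable fun q : (ℕ → ℝ) × ℝ =>
      (∑' n, if q.1 n ≤ q.2 then (1 : ENNReal) else 0) := by
    refine Measurable.tsum fun n => Measurable.ite ?_ measurable_const measurable_const
    exact measurableSet_le ((measurable_pi_apply n).comp measurable_fst) measurable_snd
  -- This also holds for infinite sets, where `ncard` and the real value of `⊤` are both `0`.
  have h2 : ∀ q : (ℕ → ℝ) × ℝ, ((arrivalCount q.1 q.2 : ℕ) : ℝ) =
      (∑' n, if q.1 n ≤ q.2 then (1 : ENNReal) else 0).toReal := by
    intro q
    have h3 : (∑' n, if q.1 n ≤ q.2 then (1 : ENNReal) else 0) = {n | q.1 n ≤ q.2}.encard := by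
      rw [← ENNReal.tsum_set_one, tsum_subtype {n | q.1 n ≤ q.2} fun _ => (1 : ENNReal)]
      exact tsum_congr fun n => by simp [Set.indicator]
    rw [h3, arrivalCount, Set.ncard_def]
    rcases eq_or_ne ({n | q.1 n ≤ q.2}.encard) ⊤ with h | h
    · simp [h]
    · lift {n | q.1 n ≤ q.2}.encard to ℕ using h with m
      simp
  refine measurable_to_countable' fun m => ?_
  have h4 : (fun q : (ℕ → ℝ) × ℝ => arrivalCount q.1 q.2) ⁻¹' {m} =
      (fun q : (ℕ → ℝ) × ℝ =>
        (∑' n, if q.1 n ≤ q.2 then (1 : ENNReal) else 0).toReal) ⁻¹' {(m : ℝ)} := by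
    ext q
    simp only [mem_preimage, mem_singleton_iff, ← h2, Nat.cast_inj]
  rw [h4]
  exact h1.ennreal_toReal (measurableSet_singleton _)

/-! ### The law of the arrival counts -/

section Law

variable {Ω : Type*} [MeasurableSpace Ω] {P : Measure Ω}
  {lam : ℝ} {μS μV : Measure ℝ} {σ S V : ℕ → Ω → ℝ}

theorem measure_increments_eq (hlam : 0 < lam) (h : IsPoissonArrivals P lam σ) {d : ℕ → ℝ}
    (hd : ∀ i, 0 ≤ d i) (b : ℕ → ℕ) (k : ℕ) :
    P {ω | ∀ i < k, arrivalCount (fun n => σ n ω) (∑ j ∈ Finset.range (i + 1), d j) -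
        arrivalCount (fun n => σ n ω) (∑ j ∈ Finset.range i, d j) = b i} =
      ∏ i ∈ Finset.range k, ENNReal.ofReal (poissonWeight (lam * d i) (b i)) := by
  let t : ℕ → ℝ≥0 := fun i => ⟨∑ j ∈ Finset.range i, d j, Finset.sum_nonneg fun j _ => hd j⟩
  have hsucc : ∀ i, (t (i + 1) : ℝ) = t i + d i := fun i => Finset.sum_range_succ _ _
  have ht : Monotone t := monotone_nat_of_le_succ fun i => by
    rw [← NNReal.coe_le_coe, hsucc]
    linarith [hd i]
  have hind := (h.indepIncrements.nat ht).measure_inter_preimage_eq_mul (Finset.range k)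
    (sets := fun i => {b i}) fun i _ => measurableSet_singleton _
  have hset : {ω | ∀ i < k, arrivalCount (fun n => σ n ω) (∑ j ∈ Finset.range (i + 1), d j) -
        arrivalCount (fun n => σ n ω) (∑ j ∈ Finset.range i, d j) = b i} =
      ⋂ i ∈ Finset.range k, (fun ω => arrivalCount (fun n => σ n ω) (t (i + 1)) -
        arrivalCount (fun n => σ n ω) (t i)) ⁻¹' {b i} := by
    ext ω
    simp only [mem_iInter, Finset.mem_range, mem_preimage, mem_singleton_iff]
    rfl
  rw [hset]
  refine hind.trans (Finset.prod_congr rfl fun i _ => ?_)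
  have hlaw := h.increments (t i) (t (i + 1)) (ht (Nat.le_succ i))
  have h1 := hlaw.measure_eq (p := fun m => m = b i) (measurableSet_singleton _)
  refine h1.trans ?_
  have h2 : lam * ((t (i + 1) : ℝ) - t i) = lam * d i := by rw [hsucc]; ring
  rw [h2]
  refine (poissonMeasure_singleton _ _).trans ?_
  rw [Real.coe_toNNReal _ (mul_nonneg hlam.le (hd i))]
  rfl

theorem ae_nonneg_of_map {X : Ω → ℝ} (hX : Measurable X) {μ : Measure ℝ} (hlaw : P.map X = μ)
    (hμ : ∀ᵐ x ∂μ, 0 ≤ x) : ∀ᵐ ω ∂P, 0 ≤ X ω := by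
  rw [← hlaw] at hμ
  exact ae_of_ae_map hX.aemeasurable hμ

theorem lintegral_poissonWeight_comp [IsProbabilityMeasure μS] (hlam : 0 < lam)
    (hμ : ∀ᵐ x ∂μS, 0 ≤ x) {X : Ω → ℝ} (hX : Measurable X) (hlaw : P.map X = μS) (b : ℕ) :
    ∫⁻ ω, ENNReal.ofReal (poissonWeight (lam * X ω) b) ∂P =
      ENNReal.ofReal (poissonMix lam μS b) := by
  have h1 : Measurable fun x => ENNReal.ofReal (poissonWeight (lam * x) b) :=
    (measurable_poissonWeight lam b).ennreal_ofReal
  rw [← lintegral_map (f := fun x => ENNReal.ofReal (poissonWeight (lam * x) b)) h1 hX, hlaw,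
    poissonMix, ofReal_integral_eq_lintegral_ofReal (integrable_poissonWeight hlam hμ b)]
  filter_upwards [hμ] with x hx
  exact poissonWeight_nonneg (by positivity) b

/-- The duration of activity `i`, as a function of the sequence of pairs of a service time and a
vacation time. -/
noncomputable def pairDuration (N : ℕ) (b : ℕ → ℕ) (y : ℕ → ℝ × ℝ) (i : ℕ) : ℝ :=
  duration N b (fun k => (y k).1) (fun k => (y k).2) i

theorem measurable_pairDuration (N : ℕ) (b : ℕ → ℕ) (i : ℕ) :
    Measurable fun y : ℕ → ℝ × ℝ => pairDuration N b y i := by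
  unfold pairDuration duration
  split_ifs
  · exact measurable_snd.comp (measurable_pi_apply i)
  · exact measurable_fst.comp (measurable_pi_apply i)

/-- The realisations with `b i` arrivals during activity `i`, for all `i < k`. -/
def prescribedArrivals (N : ℕ) (b : ℕ → ℕ) (k : ℕ) : Set ((ℕ → ℝ) × (ℕ → ℝ × ℝ)) :=
  {q | ∀ i < k, arrivalCount q.1 (∑ j ∈ Finset.range (i + 1), pairDuration N b q.2 j) -
    arrivalCount q.1 (∑ j ∈ Finset.range i, pairDuration N b q.2 j) = b i}

theorem measurableSet_prescribedArrivals (N : ℕ) (b : ℕ → ℕ) (k : ℕ) :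
    MeasurableSet (prescribedArrivals N b k) := by
  have hcount : ∀ m, Measurable fun q : (ℕ → ℝ) × (ℕ → ℝ × ℝ) =>
      arrivalCount q.1 (∑ j ∈ Finset.range m, pairDuration N b q.2 j) := by
    intro m
    have hm : Measurable fun q : (ℕ → ℝ) × (ℕ → ℝ × ℝ) =>
        ∑ j ∈ Finset.range m, pairDuration N b q.2 j :=
      Finset.measurable_fun_sum _ fun j _ => (measurable_pairDuration N b j).comp measurable_snd
    exact measurable_arrivalCount.comp (measurable_fst.prodMk hm)
  have : prescribedArrivals N b k = ⋂ i ∈ Finset.range k,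
      {q | arrivalCount q.1 (∑ j ∈ Finset.range (i + 1), pairDuration N b q.2 j) -
        arrivalCount q.1 (∑ j ∈ Finset.range i, pairDuration N b q.2 j) = b i} := by
    ext q
    simp [prescribedArrivals]
  rw [this]
  refine Finset.measurableSet_biInter _ fun i _ => ?_
  exact ((hcount (i + 1)).sub (hcount i)) (measurableSet_singleton _)

/-- By independence of arrivals and durations, Fubini freezes the durations; the independent Poisson
increments then give a product of Poisson weights. -/
theorem measure_arrivalsDuring_eq_lintegral [IsProbabilityMeasure P]
    (hlam : 0 < lam) (hS : ∀ᵐ x ∂μS, 0 ≤ x) (hV : ∀ᵐ x ∂μV, 0 ≤ x)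
    (h : IsInput P lam μS μV σ S V) (N : ℕ) (b : ℕ → ℕ) (k : ℕ) :
    P {ω | ∀ i < k, arrivalsDuring N (fun n => σ n ω) (fun n => S n ω) (fun n => V n ω) i = b i} =
      ∫⁻ ω, ∏ i ∈ Finset.range k, ENNReal.ofReal (poissonWeight
        (lam * pairDuration N b (fun n => (S n ω, V n ω)) i) (b i)) ∂P := by
  obtain ⟨X, hXdef⟩ : ∃ X : Ω → ℕ → ℝ, X = fun ω n => σ n ω := ⟨_, rfl⟩
  obtain ⟨Y, hYdef⟩ : ∃ Y : Ω → ℕ → ℝ × ℝ, Y = fun ω n => (S n ω, V n ω) := ⟨_, rfl⟩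
  have hX : Measurable X := hXdef ▸ measurable_pi_lambda _ h.arrivals.measurable
  have hY : Measurable Y := hYdef ▸ measurable_pi_lambda _ fun n =>
    (h.measurable_service n).prodMk (h.measurable_vacation n)
  have hXY : IndepFun X Y P := by
    rw [hXdef, hYdef]
    exact h.indep_arrivals
  have hG := measurableSet_prescribedArrivals N b k
  have hset : {ω | ∀ i < k, arrivalsDuring N (fun n => σ n ω) (fun n => S n ω)
      (fun n => V n ω) i = b i} = (fun ω => (X ω, Y ω)) ⁻¹' prescribedArrivals N b k := by
    ext ω
    rw [hXdef, hYdef]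
    exact arrivalsDuring_eq_iff N (fun n => σ n ω) (fun n => S n ω) (fun n => V n ω) b k
  rw [hset, ← Measure.map_apply (hX.prodMk hY) hG,
    hXY.map_prod_eq_prod_map_map hX.aemeasurable hY.aemeasurable,
    Measure.prod_apply_symm hG, lintegral_map (measurable_measure_prodMk_right hG) hY]
  have hSnn : ∀ᵐ ω ∂P, ∀ n, 0 ≤ S n ω := ae_all_iff.mpr fun n =>
    ae_nonneg_of_map (h.measurable_service n) (h.service_law n) hS
  have hVnn : ∀ᵐ ω ∂P, ∀ n, 0 ≤ V n ω := ae_all_iff.mpr fun n =>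
    ae_nonneg_of_map (h.measurable_vacation n) (h.vacation_law n) hV
  refine lintegral_congr_ae ?_
  filter_upwards [hSnn, hVnn] with ω hω1 hω2
  have hd : ∀ i, 0 ≤ pairDuration N b (Y ω) i := by
    intro i
    rw [pairDuration, duration, hYdef]
    split_ifs
    exacts [hω2 i, hω1 i]
  rw [Measure.map_apply hX (measurable_prodMk_right hG)]
  have := measure_increments_eq hlam h.arrivals hd b k
  rw [hXdef, hYdef] at *
  exact this

theorem measure_arrivalsDuring_eq [IsProbabilityMeasure P] [IsProbabilityMeasure μS]
    [IsProbabilityMeasure μV]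
    (hlam : 0 < lam) (hS : ∀ᵐ x ∂μS, 0 ≤ x) (hV : ∀ᵐ x ∂μV, 0 ≤ x)
    (h : IsInput P lam μS μV σ S V) (N : ℕ) (b : ℕ → ℕ) (k : ℕ) :
    P {ω | ∀ i < k, arrivalsDuring N (fun n => σ n ω) (fun n => S n ω) (fun n => V n ω) i = b i} =
      ∏ i ∈ Finset.range k, ENNReal.ofReal
        (activityLaw (poissonMix lam μS) (poissonMix lam μV) (level N b i) (b i)) := by
  rw [measure_arrivalsDuring_eq_lintegral hlam hS hV h]
  -- For prescribed `b`, activity `i` uses a deterministic entry of the family of all durations.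
  -- Distinct activities use distinct entries, so the durations in use are independent and the
  -- integral of the product factors.
  obtain ⟨e, he⟩ : ∃ e : ℕ → ℕ ⊕ ℕ, ∀ i, e i = if level N b i = 0 then Sum.inr i else Sum.inl i :=
    ⟨_, fun _ => rfl⟩
  have he_inj : Function.Injective e := by
    intro i j hij
    rw [he, he] at hij
    split_ifs at hij <;> simpa using hij
  have hDe : ∀ i ω, pairDuration N b (fun n => (S n ω, V n ω)) i =
      (Sum.elim S V : ℕ ⊕ ℕ → Ω → ℝ) (e i) ω := by
    intro i ω
    rw [pairDuration, duration, he]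
    split_ifs <;> rfl
  have hind := (h.indep_durations.precomp he_inj).comp
    (fun i x => ENNReal.ofReal (poissonWeight (lam * x) (b i)))
    fun i => (measurable_poissonWeight lam (b i)).ennreal_ofReal
  have hDm : ∀ i, Measurable ((Sum.elim S V : ℕ ⊕ ℕ → Ω → ℝ) (e i)) := by
    intro i
    rw [he]
    split_ifs
    exacts [h.measurable_vacation i, h.measurable_service i]
  simp only [hDe]
  refine (lintegral_prod_eq_prod_lintegral_of_indepFun (Finset.range k) _ hind fun i =>
    ((measurable_poissonWeight lam (b i)).ennreal_ofReal).comp (hDm i)).trans ?_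
  refine Finset.prod_congr rfl fun i _ => ?_
  simp only [Function.comp_apply, activityLaw]
  rw [he]
  split_ifs
  · exact lintegral_poissonWeight_comp hlam hV (h.measurable_vacation i) (h.vacation_law i) _
  · exact lintegral_poissonWeight_comp hlam hS (h.measurable_service i) (h.service_law i) _

theorem measurable_activityStart (hσ : ∀ n, Measurable (σ n)) (hS : ∀ n, Measurable (S n))
    (hV : ∀ n, Measurable (V n)) (N k : ℕ) :
    Measurable fun ω => activityStart N (fun n => σ n ω) (fun n => S n ω) (fun n => V n ω) k := by
  have hX : Measurable fun ω n => σ n ω := measurable_pi_lambda _ hσ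
  induction k with
  | zero => exact measurable_const
  | succ k ih =>
    have hx := measurable_fst.comp ih
    have ht := measurable_snd.comp ih
    have h0 : MeasurableSet {ω | (activityStart N (fun n => σ n ω) (fun n => S n ω)
        (fun n => V n ω) k).1 = 0} := hx (measurableSet_singleton 0)
    have ht' : Measurable fun ω => (activityStart N (fun n => σ n ω) (fun n => S n ω)
        (fun n => V n ω) k).2 + if (activityStart N (fun n => σ n ω) (fun n => S n ω)
        (fun n => V n ω) k).1 = 0 then V k ω else S k ω :=
      ht.add (Measurable.ite h0 (hV k) (hS k))
    have hc : ∀ {f : Ω → ℝ}, Measurable f → Measurable fun ω =>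
        arrivalCount (fun n => σ n ω) (f ω) := fun hf =>
      measurable_arrivalCount.comp (hX.prodMk hf)
    have hy := (hx.add ((hc ht').sub (hc ht))).min (measurable_const (a := N))
    exact (Measurable.ite h0 hy (hy.sub measurable_const)).prodMk ht'

theorem measurable_arrivalsDuring (hσ : ∀ n, Measurable (σ n)) (hS : ∀ n, Measurable (S n))
    (hV : ∀ n, Measurable (V n)) (N k : ℕ) : Measurable fun ω =>
      arrivalsDuring N (fun n => σ n ω) (fun n => S n ω) (fun n => V n ω) k := by
  have hX : Measurable fun ω n => σ n ω := measurable_pi_lambda _ hσ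
  have hc : ∀ k, Measurable fun ω => arrivalCount (fun n => σ n ω)
      (activityStart N (fun n => σ n ω) (fun n => S n ω) (fun n => V n ω) k).2 := fun k =>
    measurable_arrivalCount.comp
      (hX.prodMk (measurable_snd.comp (measurable_activityStart hσ hS hV N k)))
  exact (hc (k + 1)).sub (hc k)

end Law

/-! ### Lost customers along a realisation -/

/-- The number of customers who arrive before activity `k`, if `b i` customers arrive during
activity `i`. -/
def arrivedBefore (b : ℕ → ℕ) (k : ℕ) : ℕ := ∑ i ∈ Finset.range k, b i

/-- Customer `n` arrives and is lost during activity `k`, if `b i` customers arrive during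
activity `i`. -/
def LostDuring (N : ℕ) (b : ℕ → ℕ) (n k : ℕ) : Prop :=
  arrivedBefore b k ≤ n ∧ n < arrivedBefore b (k + 1) ∧ N ≤ level N b k + (n - arrivedBefore b k)

theorem arrivedBefore_mono (b : ℕ → ℕ) : Monotone (arrivedBefore b) := fun _ _ h =>
  Finset.sum_le_sum_of_subset (Finset.range_mono h)

theorem arrivedBefore_unique {b : ℕ → ℕ} {n j k : ℕ} (hj : arrivedBefore b j ≤ n)
    (hj' : n < arrivedBefore b (j + 1)) (hk : arrivedBefore b k ≤ n)
    (hk' : n < arrivedBefore b (k + 1)) : j = k := by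
  by_contra hne
  rcases Nat.lt_or_gt_of_ne hne with h | h
  · exact absurd (arrivedBefore_mono b (Nat.succ_le_of_lt h)) (by simp only [Nat.succ_eq_add_one]; omega)
  · exact absurd (arrivedBefore_mono b (Nat.succ_le_of_lt h)) (by simp only [Nat.succ_eq_add_one]; omega)

section Path

variable {σ S V : ℕ → ℝ} {N : ℕ}

theorem lt_arrivalCount_iff (hσ : StrictMono σ) (hσ' : Tendsto σ atTop atTop) (t : ℝ) (n : ℕ) :
    n < arrivalCount σ t ↔ σ n ≤ t := by
  classical
  have hex : ∃ m, t < σ m := (hσ'.eventually_gt_atTop t).exists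
  have hset : {n : ℕ | σ n ≤ t} = (Finset.range (Nat.find hex) : Finset ℕ) := by
    ext m
    simp only [mem_ofPred_eq, Finset.coe_range, mem_Iio, Nat.lt_find_iff, not_lt]
    exact ⟨fun h j hj => (hσ.monotone hj).trans h, fun h => h m le_rfl⟩
  have hcount : arrivalCount σ t = Nat.find hex := by
    rw [arrivalCount, hset, Set.ncard_coe_finset, Finset.card_range]
  have hmem : σ n ≤ t ↔ n ∈ {n : ℕ | σ n ≤ t} := Iff.rfl
  rw [hcount, hmem, hset]
  simp

theorem arrivalCount_mono (hσ : StrictMono σ) (hσ' : Tendsto σ atTop atTop) :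
    Monotone (arrivalCount σ) := by
  intro s t hst
  by_contra h
  rw [not_le, lt_arrivalCount_iff hσ hσ'] at h
  exact lt_irrefl _ ((lt_arrivalCount_iff hσ hσ' t _).mpr (h.trans hst))

theorem activityStart_snd_mono (hS : ∀ k, 0 ≤ S k) (hV : ∀ k, 0 ≤ V k) :
    Monotone fun k => (activityStart N σ S V k).2 := by
  refine monotone_nat_of_le_succ fun k => ?_
  simp only [activityStart_eq, Finset.sum_range_succ]
  have : 0 ≤ duration N (arrivalsDuring N σ S V) S V k := by
    unfold duration
    split_ifs
    exacts [hV k, hS k]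
  linarith

theorem arrivalCount_activityStart (hσ : StrictMono σ) (hσ' : Tendsto σ atTop atTop)
    (hσ0 : 0 < σ 0) (hS : ∀ k, 0 ≤ S k) (hV : ∀ k, 0 ≤ V k) (k : ℕ) :
    arrivalCount σ (activityStart N σ S V k).2 = arrivedBefore (arrivalsDuring N σ S V) k := by
  induction k with
  | zero =>
    by_contra h
    have h0 : 0 < arrivalCount σ (activityStart N σ S V 0).2 := Nat.pos_of_ne_zero h
    rw [lt_arrivalCount_iff hσ hσ'] at h0
    exact absurd h0 (not_le.mpr hσ0)
  | succ k ih =>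
    have h := arrivalCount_mono hσ hσ' (activityStart_snd_mono (N := N) (σ := σ) hS hV
      (Nat.le_succ k))
    rw [arrivedBefore, Finset.sum_range_succ, ← arrivedBefore, ← ih, arrivalsDuring]
    simp only [Nat.succ_eq_add_one] at h
    omega

/-- Just before `σ n`, exactly `n` customers have arrived and activity `k` is in progress. The
interval is open on the left and closed on the right because `arrivalCount` includes arrivals at the
endpoint. -/
theorem isLost_iff_of_mem_activity (hσ : StrictMono σ) (hσ' : Tendsto σ atTop atTop)
    (hσ0 : 0 < σ 0) (hS : ∀ k, 0 ≤ S k) (hV : ∀ k, 0 ≤ V k) {n k : ℕ}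
    (hk : (activityStart N σ S V k).2 < σ n) (hk' : σ n ≤ (activityStart N σ S V (k + 1)).2) :
    IsLost N σ S V n ↔ N ≤ level N (arrivalsDuring N σ S V) k +
      (n - arrivedBefore (arrivalsDuring N σ S V) k) := by
  have hmono := activityStart_snd_mono (N := N) (σ := σ) hS hV
  have hprev : ∀ᶠ t in 𝓝[<] (σ n), n ≤ arrivalCount σ t := by
    cases n with
    | zero => exact Eventually.of_forall fun t => Nat.zero_le _
    | succ m =>
      filter_upwards [Ioo_mem_nhdsLT (hσ (Nat.lt_succ_self m))] with t ht
      exact Nat.succ_le_of_lt ((lt_arrivalCount_iff hσ hσ' t m).mpr ht.1.le)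
  have hlen : ∀ᶠ t in 𝓝[<] (σ n), queueLength N σ S V t =
      min (level N (arrivalsDuring N σ S V) k +
        (n - arrivedBefore (arrivalsDuring N σ S V) k)) N := by
    filter_upwards [hprev, Ioo_mem_nhdsLT hk] with t ht1 ht2
    have hcur : currentActivity N σ S V t = k := by
      have hset : {j : ℕ | (activityStart N σ S V (j + 1)).2 ≤ t} =
          (Finset.range k : Finset ℕ) := by
        ext j
        simp only [mem_ofPred_eq, Finset.coe_range, mem_Iio]
        refine ⟨fun h => ?_, fun h => ?_⟩
        · by_contra hjk
          have := hmono (show k + 1 ≤ j + 1 by omega)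
          simp only at this
          linarith [ht2.2]
        · have := hmono (show j + 1 ≤ k by omega)
          simp only at this
          linarith [ht2.1]
      rw [currentActivity, hset, Set.ncard_coe_finset, Finset.card_range]
    have hcount : arrivalCount σ t = n := by
      refine le_antisymm ?_ ht1
      by_contra h
      rw [not_le, lt_arrivalCount_iff hσ hσ'] at h
      linarith [ht2.2]
    rw [queueLength, hcur, hcount, arrivalCount_activityStart hσ hσ' hσ0 hS hV, activityStart_eq]
  unfold IsLost
  constructor
  · intro h
    obtain ⟨t, h1, h2⟩ := (h.and hlen).exists
    rw [h1] at h2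
    exact min_eq_right_iff.mp h2.symm
  · intro h
    filter_upwards [hlen] with t ht
    rw [ht, min_eq_right h]

theorem isLost_iff_exists_lostDuring (hσ : StrictMono σ) (hσ' : Tendsto σ atTop atTop)
    (hσ0 : 0 < σ 0) (hS : ∀ k, 0 ≤ S k) (hV : ∀ k, 0 ≤ V k) {n : ℕ}
    (hn : ∃ k, n < arrivedBefore (arrivalsDuring N σ S V) k) :
    IsLost N σ S V n ↔ ∃ k, LostDuring N (arrivalsDuring N σ S V) n k := by
  classical
  have hcount := arrivalCount_activityStart (N := N) hσ hσ' hσ0 hS hV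
  obtain ⟨k, hk, hk'⟩ : ∃ k, arrivedBefore (arrivalsDuring N σ S V) k ≤ n ∧
      n < arrivedBefore (arrivalsDuring N σ S V) (k + 1) := by
    have h0 : Nat.find hn ≠ 0 := by
      intro h
      have := Nat.find_spec hn
      rw [h] at this
      simp [arrivedBefore] at this
    obtain ⟨k, hk⟩ := Nat.exists_eq_succ_of_ne_zero h0
    refine ⟨k, not_lt.mp (Nat.find_min hn (by omega)), ?_⟩
    have := Nat.find_spec hn
    rwa [hk] at this
  have h1 : (activityStart N σ S V k).2 < σ n := by
    rw [← not_le, ← lt_arrivalCount_iff hσ hσ', hcount]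
    exact not_lt.mpr hk
  have h2 : σ n ≤ (activityStart N σ S V (k + 1)).2 := by
    rw [← lt_arrivalCount_iff hσ hσ', hcount]
    exact hk'
  rw [isLost_iff_of_mem_activity hσ hσ' hσ0 hS hV h1 h2]
  refine ⟨fun h => ⟨k, hk, hk', h⟩, ?_⟩
  rintro ⟨j, hj, hj', h⟩
  rwa [arrivedBefore_unique hj hj' hk hk'] at h

end Path

/-! ### The loss probability of a given customer -/

/-- The probability that customer `n` is lost, if an activity is about to begin with `x` customers
in the system of capacity `N`. -/
noncomputable def lossFrom (a v : ℕ → ℝ) (N : ℕ) (n : ℕ) : ℕ → ℝ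
  | 0 => (lossNow a v N n 0 +
      ∑ b : Fin n, v (b + 1) * lossFrom a v N (n - (b + 1)) (step N 0 (b + 1))) / (1 - v 0)
  | x + 1 => lossNow a v N n (x + 1) + (a 0 * lossFrom a v N n x +
      ∑ b : Fin n, a (b + 1) * lossFrom a v N (n - (b + 1)) (step N (x + 1) (b + 1)))
termination_by x => (n, x)
decreasing_by
  · exact Prod.Lex.left _ _ (by omega)
  · exact Prod.Lex.right _ (by omega)
  · exact Prod.Lex.left _ _ (by omega)

section LossFrom

variable {a v : ℕ → ℝ} {N : ℕ}

theorem pmf_zero_lt_one (ha : ∀ b, 0 < a b) (hsum : HasSum a 1) : a 0 < 1 := by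
  have := tail_pos ha hsum 0
  rw [tail_zero] at this
  linarith

/-- The term `b = 0` does not decrease `n`. For a service it decreases `x`, hence the lexicographic
recursion; for a vacation it returns to the same pair, and solving for that term gives the factor
$1/(1 - v_0)$. -/
theorem lossFrom_eq (hv : ∀ b, 0 < v b) (hvsum : HasSum v 1) (n x : ℕ) (hx : x ≤ N) :
    lossFrom a v N n x = lossNow a v N n x + ∑ b ∈ Finset.range (n + 1),
      activityLaw a v x b * lossFrom a v N (n - b) (step N x b) := by
  rw [Finset.sum_range_succ', Nat.sub_zero]
  cases x with
  | zero =>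
    have h : lossFrom a v N n 0 = (lossNow a v N n 0 + ∑ b ∈ Finset.range n,
        v (b + 1) * lossFrom a v N (n - (b + 1)) (step N 0 (b + 1))) / (1 - v 0) := by
      rw [lossFrom, Finset.sum_range fun b =>
        v (b + 1) * lossFrom a v N (n - (b + 1)) (step N 0 (b + 1))]
    have hv0 := pmf_zero_lt_one hv hvsum
    rw [eq_div_iff (by linarith)] at h
    have h0 : step N 0 0 = 0 := by simp [step]
    rw [h0]
    simp only [activityLaw, if_true]
    linarith
  | succ x =>
    have h0 : step N (x + 1) 0 = x := by
      rw [step, if_neg (Nat.succ_ne_zero x), add_zero, min_eq_left hx, Nat.add_sub_cancel]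
    rw [lossFrom, h0, Finset.sum_range fun b =>
      activityLaw a v (x + 1) (b + 1) * lossFrom a v N (n - (b + 1)) (step N (x + 1) (b + 1))]
    simp only [activityLaw, Nat.succ_ne_zero, if_false]
    ring

theorem lossNow_nonneg (ha : ∀ b, 0 < a b) (hsum : HasSum a 1) (hv : ∀ b, 0 < v b)
    (hvsum : HasSum v 1) (n x : ℕ) : 0 ≤ lossNow a v N n x := by
  unfold lossNow activityLaw
  split_ifs
  exacts [(tail_pos hv hvsum n).le, (tail_pos ha hsum n).le, le_rfl]

theorem lossNow_le (ha : ∀ b, 0 < a b) (hsum : HasSum a 1) (hv : ∀ b, 0 < v b)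
    (hvsum : HasSum v 1) (n x : ℕ) : lossNow a v N n x ≤ tail (activityLaw a v x) n := by
  unfold lossNow activityLaw
  split_ifs
  exacts [le_rfl, le_rfl, (tail_pos hv hvsum n).le, (tail_pos ha hsum n).le]

theorem sum_mul_mem_Icc {p g : ℕ → ℝ} (hp : ∀ b, 0 < p b) (n : ℕ)
    (hg : ∀ b < n, g b ∈ Icc (0 : ℝ) 1) :
    ∑ b ∈ Finset.range n, p (b + 1) * g b ∈ Icc 0 (1 - p 0 - tail p n) := by
  refine ⟨Finset.sum_nonneg fun b hb =>
    mul_nonneg (hp _).le (hg b (Finset.mem_range.mp hb)).1, ?_⟩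
  rw [tail, Finset.sum_range_succ']
  have : ∑ b ∈ Finset.range n, p (b + 1) * g b ≤ ∑ b ∈ Finset.range n, p (b + 1) :=
    Finset.sum_le_sum fun b hb =>
      mul_le_of_le_one_right (hp _).le (hg b (Finset.mem_range.mp hb)).2
  linarith

theorem lossFrom_mem_Icc (ha : ∀ b, 0 < a b) (hsum : HasSum a 1) (hv : ∀ b, 0 < v b)
    (hvsum : HasSum v 1) (n x : ℕ) : lossFrom a v N n x ∈ Icc (0 : ℝ) 1 := by
  induction n using Nat.strong_induction_on generalizing x with
  | _ n ih =>
    induction x with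
    | zero =>
      have h := sum_mul_mem_Icc hv n
        (g := fun b => lossFrom a v N (n - (b + 1)) (step N 0 (b + 1)))
        fun b hb => ih _ (by omega) _
      have h1 := lossNow_nonneg (N := N) ha hsum hv hvsum n 0
      have h2 := lossNow_le (N := N) ha hsum hv hvsum n 0
      have hv0 := pmf_zero_lt_one hv hvsum
      simp only [activityLaw, if_true] at h2
      rw [lossFrom, ← Finset.sum_range fun b =>
        v (b + 1) * lossFrom a v N (n - (b + 1)) (step N 0 (b + 1))]
      refine ⟨div_nonneg (add_nonneg h1 h.1) (by linarith), ?_⟩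
      rw [div_le_one (by linarith)]
      linarith [h.2]
    | succ x ihx =>
      have h := sum_mul_mem_Icc ha n
        (g := fun b => lossFrom a v N (n - (b + 1)) (step N (x + 1) (b + 1)))
        fun b hb => ih _ (by omega) _
      have h1 := lossNow_nonneg (N := N) ha hsum hv hvsum n (x + 1)
      have h2 := lossNow_le (N := N) ha hsum hv hvsum n (x + 1)
      have h3 := mul_nonneg (ha 0).le ihx.1
      have h4 := mul_le_of_le_one_right (ha 0).le ihx.2
      simp only [activityLaw, Nat.succ_ne_zero, if_false] at h2
      rw [lossFrom, ← Finset.sum_range fun b =>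
        a (b + 1) * lossFrom a v N (n - (b + 1)) (step N (x + 1) (b + 1))]
      exact ⟨add_nonneg h1 (add_nonneg h3 h.1), by linarith [h.2]⟩

/-- The expected contribution to the loss probability of customer `n`, when `m` customers have
arrived before the current activity, which begins with `x` customers. -/
noncomputable def lossValue (a v : ℕ → ℝ) (N n m x : ℕ) : ℝ :=
  if m ≤ n then lossFrom a v N (n - m) x else 0

theorem lossValue_mem_Icc (ha : ∀ b, 0 < a b) (hsum : HasSum a 1) (hv : ∀ b, 0 < v b)
    (hvsum : HasSum v 1) (n m x : ℕ) : lossValue a v N n m x ∈ Icc (0 : ℝ) 1 := by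
  unfold lossValue
  split_ifs
  exacts [lossFrom_mem_Icc ha hsum hv hvsum _ _, ⟨le_rfl, zero_le_one⟩]

theorem activityLaw_pos (ha : ∀ b, 0 < a b) (hv : ∀ b, 0 < v b) (x b : ℕ) :
    0 < activityLaw a v x b := by
  unfold activityLaw
  split_ifs
  exacts [hv b, ha b]

theorem hasSum_activityLaw (hsum : HasSum a 1) (hvsum : HasSum v 1) (x : ℕ) :
    HasSum (activityLaw a v x) 1 := by
  unfold activityLaw
  split_ifs
  exacts [hvsum, hsum]

-- Martingale property: the value before an activity is the chance of being lost during it plus the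
-- mean value afterwards. It is the renewal equation of `lossFrom`, with `m` recording the customers
-- already counted.
open Classical in
theorem tsum_lossValue (hsum : HasSum a 1) (hv : ∀ b, 0 < v b) (hvsum : HasSum v 1) {x : ℕ}
    (hx : x ≤ N) (n m : ℕ) :
    ∑' b, activityLaw a v x b * ((if m ≤ n ∧ n < m + b ∧ N ≤ x + (n - m) then 1 else 0) +
      lossValue a v N n (m + b) (step N x b)) = lossValue a v N n m x := by
  by_cases hm : m ≤ n
  · obtain ⟨d, rfl⟩ := Nat.exists_eq_add_of_le hm
    have hp := hasSum_activityLaw hsum hvsum x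
    have h1 : HasSum (fun b => activityLaw a v x b *
        (if m ≤ m + d ∧ m + d < m + b ∧ N ≤ x + (m + d - m) then 1 else 0))
        (lossNow a v N d x) := by
      unfold lossNow
      by_cases hN : N ≤ x + d
      · rw [if_pos hN]
        refine hasSum_of_forall_eq (hasSum_tail hp d) fun b => ?_
        simp [hN]
      · simp [hN, hasSum_zero]
    have h2 : HasSum (fun b => activityLaw a v x b * lossValue a v N (m + d) (m + b) (step N x b))
        (∑ b ∈ Finset.range (d + 1),
          activityLaw a v x b * lossFrom a v N (d - b) (step N x b)) := by
      have h3 := hasSum_sum_of_ne_finset_zero (f := fun b => activityLaw a v x b *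
        lossValue a v N (m + d) (m + b) (step N x b)) (s := Finset.range (d + 1))
        (L := SummationFilter.unconditional ℕ) fun b hb => by
          rw [lossValue, if_neg (by simp at hb; omega), mul_zero]
      rwa [Finset.sum_congr rfl fun b hb => by
        rw [lossValue, if_pos (by simp at hb; omega), Nat.add_sub_add_left]] at h3
    have h4 := (hasSum_of_forall_eq (h1.add h2) fun b => (mul_add _ _ _).symm).tsum_eq
    rw [h4, lossValue, if_pos hm, Nat.add_sub_cancel_left, lossFrom_eq hv hvsum d x hx]
  · rw [lossValue, if_neg hm]
    refine (tsum_congr fun b => ?_).trans tsum_zero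
    rw [if_neg fun h => hm h.1, lossValue, if_neg (by omega)]
    simp

end LossFrom

/-! ### The arrival counts as a Markov chain -/

/-- The sequence that begins with the finite sequence `h` and goes on with the constant `b`. -/
def extendBy {k : ℕ} (h : Fin k → ℕ) (b : ℕ) (i : ℕ) : ℕ := if hi : i < k then h ⟨i, hi⟩ else b

theorem extendBy_of_lt {k : ℕ} (h : Fin k → ℕ) (b : ℕ) {i : ℕ} (hi : i < k) :
    extendBy h b i = h ⟨i, hi⟩ := dif_pos hi

theorem extendBy_self {k : ℕ} (h : Fin k → ℕ) (b : ℕ) : extendBy h b k = b :=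
  dif_neg (lt_irrefl k)

theorem arrivedBefore_congr {b b' : ℕ → ℕ} {k : ℕ} (h : ∀ i < k, b i = b' i) :
    arrivedBefore b k = arrivedBefore b' k :=
  Finset.sum_congr rfl fun i hi => h i (Finset.mem_range.mp hi)

theorem arrivedBefore_succ (b : ℕ → ℕ) (k : ℕ) :
    arrivedBefore b (k + 1) = arrivedBefore b k + b k :=
  Finset.sum_range_succ _ _

section Chain

variable {Ω : Type*} [MeasurableSpace Ω] {P : Measure Ω} [IsProbabilityMeasure P]
  {a v : ℕ → ℝ} {N : ℕ} {B : ℕ → Ω → ℕ}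

/-- The Markov property in integrated form: given the first `k` counts, the next has law
`activityLaw` at the current level. Histories are countable, so it follows by summation from the
product formula for cylinders. -/
theorem integral_eq_integral_tsum (ha : ∀ b, 0 < a b) (hsum : HasSum a 1) (hv : ∀ b, 0 < v b)
    (hvsum : HasSum v 1) (hB : ∀ k, Measurable (B k))
    (hlaw : ∀ (b : ℕ → ℕ) (k : ℕ), P {ω | ∀ i < k, B i ω = b i} =
      ∏ i ∈ Finset.range k, ENNReal.ofReal (activityLaw a v (level N b i) (b i)))
    (k : ℕ) {G : (ℕ → ℕ) → ℕ → ℝ} {K : ℝ} (hK : ∀ b m, |G b m| ≤ K)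
    (hdep : ∀ b b', (∀ i < k, b i = b' i) → G b = G b') :
    ∫ ω, G (fun i => B i ω) (B k ω) ∂P =
      ∫ ω, ∑' m, activityLaw a v (level N (fun i => B i ω) k) m * G (fun i => B i ω) m ∂P := by
  obtain ⟨H, hH⟩ : ∃ H : Ω → Fin k → ℕ, ∀ ω i, H ω i = B i ω := ⟨fun ω i => B i ω, fun _ _ => rfl⟩
  have hHm : Measurable H := measurable_pi_lambda _ fun i => by simpa only [hH] using hB i
  have hpair : Measurable fun ω => (H ω, B k ω) := hHm.prodMk (hB k)
  have hext : ∀ ω, ∀ i < k, B i ω = extendBy (H ω) 0 i := fun ω i hi => by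
    rw [extendBy_of_lt _ _ hi, hH]
  let F : (Fin k → ℕ) × ℕ → ℝ := fun q => G (extendBy q.1 0) q.2
  let g : (Fin k → ℕ) → ℝ := fun h =>
    ∑' m, activityLaw a v (level N (extendBy h 0) k) m * G (extendBy h 0) m
  have hp := fun x b => (activityLaw_pos ha hv x b).le
  have hps := hasSum_activityLaw hsum hvsum
  have hgK : ∀ h, |g h| ≤ K := by
    intro h
    have h1 := summable_mul_of_abs_le (hp (level N (extendBy h 0) k)) (hps _).summable
      (hK (extendBy h 0))
    have h2 := (hps (level N (extendBy h 0) k)).mul_right K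
    rw [one_mul] at h2
    refine abs_le.mpr ⟨?_, ?_⟩
    · refine hasSum_le (fun m => ?_) h2.neg h1.hasSum
      nlinarith [mul_le_mul_of_nonneg_left (abs_le.mp (hK (extendBy h 0) m)).1
        (hp (level N (extendBy h 0) k) m)]
    · exact hasSum_le (fun m => mul_le_mul_of_nonneg_left (abs_le.mp (hK _ m)).2 (hp _ m))
        h1.hasSum h2
  have hFint : Integrable F (P.map fun ω => (H ω, B k ω)) := by
    have := Measure.isProbabilityMeasure_map (μ := P) hpair.aemeasurable
    exact Integrable.of_bound .of_discrete K (Eventually.of_forall fun q => hK _ _)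
  have hgint : Integrable g (P.map H) := by
    have := Measure.isProbabilityMeasure_map (μ := P) hHm.aemeasurable
    exact Integrable.of_bound .of_discrete K (Eventually.of_forall fun q => hgK _)
  have hleft : ∫ ω, G (fun i => B i ω) (B k ω) ∂P = ∫ q, F q ∂(P.map fun ω => (H ω, B k ω)) := by
    rw [integral_map hpair.aemeasurable .of_discrete]
    refine integral_congr_ae (Eventually.of_forall fun ω => ?_)
    simp only [F]
    rw [hdep _ _ (hext ω)]
  have hright : ∫ ω, ∑' m, activityLaw a v (level N (fun i => B i ω) k) m *
      G (fun i => B i ω) m ∂P = ∫ h, g h ∂(P.map H) := by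
    rw [integral_map hHm.aemeasurable .of_discrete]
    refine integral_congr_ae (Eventually.of_forall fun ω => ?_)
    simp only [g]
    rw [hdep _ _ (hext ω), level_congr (hext ω)]
  have hmass : ∀ h m, (P.map fun ω => (H ω, B k ω)).real {(h, m)} =
      (P.map H).real {h} * activityLaw a v (level N (extendBy h 0) k) m := by
    intro h m
    have h1 : (fun ω => (H ω, B k ω)) ⁻¹' {(h, m)} = {ω | ∀ i < k + 1, B i ω = extendBy h m i} := by
      ext ω
      simp only [mem_preimage, mem_singleton_iff, Prod.mk.injEq, mem_ofPred_eq]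
      constructor
      · rintro ⟨rfl, rfl⟩ i hi
        rcases Nat.lt_succ_iff_lt_or_eq.mp hi with hi | rfl
        · rw [extendBy_of_lt _ _ hi, hH]
        · rw [extendBy_self]
      · intro hi
        refine ⟨funext fun i => ?_, ?_⟩
        · rw [hH, hi i (by omega), extendBy_of_lt _ _ i.2]
        · rw [hi k (Nat.lt_succ_self k), extendBy_self]
    have h2 : H ⁻¹' {h} = {ω | ∀ i < k, B i ω = extendBy h m i} := by
      ext ω
      simp only [mem_preimage, mem_singleton_iff, mem_ofPred_eq]
      constructor
      · rintro rfl i hi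
        rw [extendBy_of_lt _ _ hi, hH]
      · exact fun hi => funext fun i => by rw [hH, hi i i.2, extendBy_of_lt _ _ i.2]
    have h3 : level N (extendBy h m) k = level N (extendBy h 0) k := level_congr fun i hi => by
      rw [extendBy_of_lt _ _ hi, extendBy_of_lt _ _ hi]
    rw [map_measureReal_apply hpair (measurableSet_singleton _),
      map_measureReal_apply hHm (measurableSet_singleton _), h1, h2, measureReal_def, hlaw,
      measureReal_def, hlaw, Finset.prod_range_succ, ENNReal.toReal_mul, extendBy_self, h3,
      ENNReal.toReal_ofReal (hp _ _)]
  have hreal : Summable fun q => (P.map fun ω => (H ω, B k ω)).real {q} := by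
    have := Measure.isProbabilityMeasure_map (μ := P) hpair.aemeasurable
    refine ENNReal.summable_toReal ?_
    have h1 := lintegral_countable' (μ := P.map fun ω => (H ω, B k ω)) fun _ => 1
    simp only [one_mul, lintegral_const, measure_univ] at h1
    rw [← h1]
    exact ENNReal.one_ne_top
  have hFs : Summable fun q => (P.map fun ω => (H ω, B k ω)).real {q} • F q := by
    refine Summable.of_norm_bounded (hreal.mul_right K) fun q => ?_
    rw [norm_smul, Real.norm_eq_abs, Real.norm_eq_abs, abs_of_nonneg measureReal_nonneg]
    exact mul_le_mul_of_nonneg_left (hK _ _) measureReal_nonneg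
  rw [hleft, hright, integral_countable hFint, integral_countable hgint, hFs.tsum_prod]
  refine tsum_congr fun h => ?_
  simp only [hmass, smul_eq_mul, g, F, mul_assoc]
  exact tsum_mul_left

theorem tsum_half_pow_lt_one {p : ℕ → ℝ} (hp : ∀ b, 0 < p b) (hsum : HasSum p 1) :
    ∑' b, p b * (1 / 2 : ℝ) ^ b < 1 := by
  have hle : ∀ b : ℕ, (1 / 2 : ℝ) ^ b ≤ 1 := fun b => pow_le_one₀ (by norm_num) (by norm_num)
  have h1 : Summable fun b => p b * (1 / 2 : ℝ) ^ b :=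
    summable_mul_of_abs_le (fun b => (hp b).le) hsum.summable (K := 1) fun b => by
      rw [abs_of_nonneg (by positivity)]
      exact hle b
  refine lt_of_lt_of_eq (h1.tsum_lt_tsum (i := 1)
    (fun b => mul_le_of_le_one_right (hp b).le (hle b)) ?_ hsum.summable) hsum.tsum_eq
  have := hp 1
  norm_num
  linarith

theorem measurable_level (hB : ∀ k, Measurable (B k)) (N k : ℕ) :
    Measurable fun ω => level N (fun i => B i ω) k := by
  induction k with
  | zero => exact measurable_const
  | succ k ih =>
    exact (Measurable.of_discrete (f := fun q : ℕ × ℕ => step N q.1 q.2)).comp (ih.prodMk (hB k))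

theorem measurable_arrivedBefore (hB : ∀ k, Measurable (B k)) (k : ℕ) :
    Measurable fun ω => arrivedBefore (fun i => B i ω) k :=
  Finset.measurable_fun_sum _ fun i _ => hB i

/-- A Chernoff bound: each activity multiplies the mean of $2^{-A}$, with $A$ the number of arrivals
so far, by at most `r`. With `r < 1`, Markov's inequality then shows that customer `n` almost surely
arrives during some activity. -/
theorem integral_half_pow_arrivedBefore_le (ha : ∀ b, 0 < a b) (hsum : HasSum a 1)
    (hv : ∀ b, 0 < v b) (hvsum : HasSum v 1) (hB : ∀ k, Measurable (B k))
    (hlaw : ∀ (b : ℕ → ℕ) (k : ℕ), P {ω | ∀ i < k, B i ω = b i} =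
      ∏ i ∈ Finset.range k, ENNReal.ofReal (activityLaw a v (level N b i) (b i))) {r : ℝ}
    (hra : ∑' b, a b * (1 / 2 : ℝ) ^ b ≤ r) (hrv : ∑' b, v b * (1 / 2 : ℝ) ^ b ≤ r) (k : ℕ) :
    ∫ ω, (1 / 2 : ℝ) ^ arrivedBefore (fun i => B i ω) k ∂P ≤ r ^ k := by
  have hint : ∀ k, Integrable (fun ω => (1 / 2 : ℝ) ^ arrivedBefore (fun i => B i ω) k) P := by
    intro k
    refine Integrable.of_bound ((Measurable.of_discrete (f := fun m : ℕ => (1 / 2 : ℝ) ^ m)).comp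
      (measurable_arrivedBefore hB k)).aestronglyMeasurable 1 (Eventually.of_forall fun ω => ?_)
    rw [Real.norm_eq_abs, abs_of_nonneg (by positivity)]
    exact pow_le_one₀ (by norm_num) (by norm_num)
  have hr0 : 0 ≤ r := (tsum_nonneg fun b => mul_nonneg (ha b).le (by positivity)).trans hra
  induction k with
  | zero => simp [arrivedBefore]
  | succ k ih =>
    have h := integral_eq_integral_tsum ha hsum hv hvsum hB hlaw k
      (G := fun b m => (1 / 2 : ℝ) ^ (arrivedBefore b k + m)) (K := 1) (fun b m => by
        rw [abs_of_nonneg (by positivity)]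
        exact pow_le_one₀ (by norm_num) (by norm_num))
      (fun b b' hb => by simp only [arrivedBefore_congr hb])
    simp only [← arrivedBefore_succ (fun i => B i _)] at h
    rw [h]
    have hstep : ∀ ω, ∑' m, activityLaw a v (level N (fun i => B i ω) k) m *
        (1 / 2 : ℝ) ^ (arrivedBefore (fun i => B i ω) k + m) ≤
        r * (1 / 2 : ℝ) ^ arrivedBefore (fun i => B i ω) k := by
      intro ω
      have h1 : ∑' m, activityLaw a v (level N (fun i => B i ω) k) m *
          (1 / 2 : ℝ) ^ (arrivedBefore (fun i => B i ω) k + m) =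
          (∑' m, activityLaw a v (level N (fun i => B i ω) k) m * (1 / 2 : ℝ) ^ m) *
            (1 / 2 : ℝ) ^ arrivedBefore (fun i => B i ω) k := by
        rw [← tsum_mul_right]
        exact tsum_congr fun m => by rw [pow_add]; ring
      rw [h1]
      refine mul_le_mul_of_nonneg_right ?_ (by positivity)
      unfold activityLaw
      split_ifs
      exacts [hrv, hra]
    calc _ ≤ ∫ ω, r * (1 / 2 : ℝ) ^ arrivedBefore (fun i => B i ω) k ∂P :=
          integral_mono_of_nonneg (Eventually.of_forall fun ω => tsum_nonneg fun m =>
            mul_nonneg (activityLaw_pos ha hv _ _).le (by positivity)) ((hint k).const_mul r)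
            (Eventually.of_forall hstep)
      _ = r * ∫ ω, (1 / 2 : ℝ) ^ arrivedBefore (fun i => B i ω) k ∂P := integral_const_mul _ _
      _ ≤ r ^ (k + 1) := by
        rw [pow_succ']
        exact mul_le_mul_of_nonneg_left ih hr0

theorem tendsto_measure_arrivedBefore_le (ha : ∀ b, 0 < a b) (hsum : HasSum a 1)
    (hv : ∀ b, 0 < v b) (hvsum : HasSum v 1) (hB : ∀ k, Measurable (B k))
    (hlaw : ∀ (b : ℕ → ℕ) (k : ℕ), P {ω | ∀ i < k, B i ω = b i} =
      ∏ i ∈ Finset.range k, ENNReal.ofReal (activityLaw a v (level N b i) (b i))) (n : ℕ) :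
    Tendsto (fun k => P.real {ω | arrivedBefore (fun i => B i ω) k ≤ n}) atTop (𝓝 0) := by
  set r := max (∑' b, a b * (1 / 2 : ℝ) ^ b) (∑' b, v b * (1 / 2 : ℝ) ^ b) with hr
  have hr1 : r < 1 := max_lt (tsum_half_pow_lt_one ha hsum) (tsum_half_pow_lt_one hv hvsum)
  have hr0 : 0 ≤ r :=
    (tsum_nonneg fun b => mul_nonneg (ha b).le (by positivity)).trans (le_max_left _ _)
  have hlim : Tendsto (fun k => 2 ^ n * r ^ k) atTop (𝓝 0) := by
    simpa using (tendsto_pow_atTop_nhds_zero_of_lt_one hr0 hr1).const_mul (2 ^ n : ℝ)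
  refine squeeze_zero (fun k => measureReal_nonneg) (fun k => ?_) hlim
  have hint : Integrable (fun ω => (1 / 2 : ℝ) ^ arrivedBefore (fun i => B i ω) k) P := by
    refine Integrable.of_bound ((Measurable.of_discrete (f := fun m : ℕ => (1 / 2 : ℝ) ^ m)).comp
      (measurable_arrivedBefore hB k)).aestronglyMeasurable 1 (Eventually.of_forall fun ω => ?_)
    rw [Real.norm_eq_abs, abs_of_nonneg (by positivity)]
    exact pow_le_one₀ (by norm_num) (by norm_num)
  have h1 := mul_meas_ge_le_integral_of_nonneg
    (Eventually.of_forall fun ω => by positivity) hint ((1 / 2 : ℝ) ^ n)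
  have h2 := h1.trans (integral_half_pow_arrivedBefore_le ha hsum hv hvsum hB hlaw
    (le_max_left _ _) (le_max_right _ _) k)
  have h3 : P.real {ω | arrivedBefore (fun i => B i ω) k ≤ n} ≤
      P.real {ω | (1 / 2 : ℝ) ^ n ≤ (1 / 2 : ℝ) ^ arrivedBefore (fun i => B i ω) k} :=
    measureReal_mono fun ω hω =>
      pow_le_pow_of_le_one (a := (1 / 2 : ℝ)) (by norm_num) (by norm_num) hω
  calc _ ≤ _ := h3
    _ = 2 ^ n * ((1 / 2 : ℝ) ^ n * P.real {ω | (1 / 2 : ℝ) ^ n ≤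
        (1 / 2 : ℝ) ^ arrivedBefore (fun i => B i ω) k}) := by
      rw [← mul_assoc, ← mul_pow]
      norm_num
    _ ≤ _ := mul_le_mul_of_nonneg_left h2 (by positivity)

theorem measurableSet_lostDuring (hB : ∀ k, Measurable (B k)) (N n k : ℕ) :
    MeasurableSet {ω | LostDuring N (fun i => B i ω) n k} := by
  have h := ((measurable_arrivedBefore hB k).prodMk (measurable_arrivedBefore hB (k + 1))).prodMk
    (measurable_level hB N k)
  exact h (t := {q | q.1.1 ≤ n ∧ n < q.1.2 ∧ N ≤ q.2 + (n - q.1.1)}) .of_discrete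

open Classical in
theorem measure_lostDuring (ha : ∀ b, 0 < a b) (hsum : HasSum a 1) (hv : ∀ b, 0 < v b)
    (hvsum : HasSum v 1) (hB : ∀ k, Measurable (B k))
    (hlaw : ∀ (b : ℕ → ℕ) (k : ℕ), P {ω | ∀ i < k, B i ω = b i} =
      ∏ i ∈ Finset.range k, ENNReal.ofReal (activityLaw a v (level N b i) (b i))) (n k : ℕ) :
    P.real {ω | LostDuring N (fun i => B i ω) n k} =
      ∫ ω, lossValue a v N n (arrivedBefore (fun i => B i ω) k) (level N (fun i => B i ω) k) ∂P -
      ∫ ω, lossValue a v N n (arrivedBefore (fun i => B i ω) (k + 1))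
        (level N (fun i => B i ω) (k + 1)) ∂P := by
  have hval := lossValue_mem_Icc (N := N) ha hsum hv hvsum n
  have h := integral_eq_integral_tsum ha hsum hv hvsum hB hlaw k
    (G := fun b m => (if arrivedBefore b k ≤ n ∧ n < arrivedBefore b k + m ∧
      N ≤ level N b k + (n - arrivedBefore b k) then 1 else 0) +
      lossValue a v N n (arrivedBefore b k + m) (step N (level N b k) m)) (K := 2)
    (fun b m => by
      have h1 := hval (arrivedBefore b k + m) (step N (level N b k) m)
      rw [abs_le]
      split_ifs <;> constructor <;> linarith [h1.1, h1.2])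
    (fun b b' hb => by simp only [arrivedBefore_congr hb, level_congr hb])
  simp only [tsum_lossValue hsum hv hvsum (level_le _ _ _)] at h
  rw [← h]
  have hm : ∀ k, Integrable (fun ω => lossValue a v N n (arrivedBefore (fun i => B i ω) k)
      (level N (fun i => B i ω) k)) P := by
    intro k
    refine Integrable.of_bound ((Measurable.of_discrete
      (f := fun q : ℕ × ℕ => lossValue a v N n q.1 q.2)).comp
      ((measurable_arrivedBefore hB k).prodMk (measurable_level hB N k))).aestronglyMeasurable 1
      (Eventually.of_forall fun ω => ?_)
    rw [Real.norm_eq_abs, abs_of_nonneg (hval _ _).1]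
    exact (hval _ _).2
  have hms := measurableSet_lostDuring hB N n k
  have hind : ∀ ω, (if arrivedBefore (fun i => B i ω) k ≤ n ∧
      n < arrivedBefore (fun i => B i ω) k + B k ω ∧
      N ≤ level N (fun i => B i ω) k + (n - arrivedBefore (fun i => B i ω) k)
      then (1 : ℝ) else 0) = {ω | LostDuring N (fun i => B i ω) n k}.indicator 1 ω := by
    intro ω
    simp only [Set.indicator, LostDuring, mem_ofPred_eq, Pi.one_apply, arrivedBefore_succ]
  have hnext : ∀ ω, lossValue a v N n (arrivedBefore (fun i => B i ω) k + B k ω)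
      (step N (level N (fun i => B i ω) k) (B k ω)) = lossValue a v N n
      (arrivedBefore (fun i => B i ω) (k + 1)) (level N (fun i => B i ω) (k + 1)) := by
    intro ω
    rw [arrivedBefore_succ, level]
  simp only [hind, hnext]
  rw [integral_add (f := {ω | LostDuring N (fun i => B i ω) n k}.indicator 1)
    ((integrable_const (1 : ℝ)).indicator hms) (hm (k + 1)), integral_indicator_one hms]
  exact (add_sub_cancel_right _ _).symm

/-- The differences in `measure_lostDuring` telescope over the disjoint events. The remainder is at
most the probability that customer `n` has not arrived before activity `J`, which tends to zero. -/
theorem measure_exists_lostDuring (ha : ∀ b, 0 < a b) (hsum : HasSum a 1) (hv : ∀ b, 0 < v b)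
    (hvsum : HasSum v 1) (hB : ∀ k, Measurable (B k))
    (hlaw : ∀ (b : ℕ → ℕ) (k : ℕ), P {ω | ∀ i < k, B i ω = b i} =
      ∏ i ∈ Finset.range k, ENNReal.ofReal (activityLaw a v (level N b i) (b i))) (n : ℕ) :
    P.real {ω | ∃ k, LostDuring N (fun i => B i ω) n k} = lossFrom a v N n 0 := by
  have hval := lossValue_mem_Icc (N := N) ha hsum hv hvsum n
  set E : ℕ → ℝ := fun k => ∫ ω, lossValue a v N n (arrivedBefore (fun i => B i ω) k)
    (level N (fun i => B i ω) k) ∂P with hE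
  set p : ℕ → ℝ := fun k => P.real {ω | arrivedBefore (fun i => B i ω) k ≤ n} with hp
  have hlim : Tendsto p atTop (𝓝 0) :=
    tendsto_measure_arrivedBefore_le ha hsum hv hvsum hB hlaw n
  have hE0 : E 0 = lossFrom a v N n 0 := by
    simp [hE, arrivedBefore, level, lossValue]
  have hEp : ∀ k, 0 ≤ E k ∧ E k ≤ p k := by
    intro k
    refine ⟨integral_nonneg fun ω => (hval _ _).1, ?_⟩
    have hms : MeasurableSet {ω | arrivedBefore (fun i => B i ω) k ≤ n} :=
      measurable_arrivedBefore hB k (t := Iic n) .of_discrete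
    simp only [hp]
    rw [← integral_indicator_one hms]
    refine integral_mono_of_nonneg (Eventually.of_forall fun ω => (hval _ _).1)
      ((integrable_const (1 : ℝ)).indicator hms) (Eventually.of_forall fun ω => ?_)
    by_cases h : arrivedBefore (fun i => B i ω) k ≤ n
    · rw [Set.indicator_of_mem (by exact h)]
      exact (hval _ _).2
    · rw [Set.indicator_of_notMem (by exact h)]
      simp only [lossValue, if_neg h, le_refl]
  have hfin : ∀ J, P.real (⋃ k ∈ Finset.range J, {ω | LostDuring N (fun i => B i ω) n k}) =
      E 0 - E J := by
    intro J
    rw [measureReal_biUnion_finset, ← Finset.sum_range_sub']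
    · exact Finset.sum_congr rfl fun k _ => measure_lostDuring ha hsum hv hvsum hB hlaw n k
    · intro j _ k _ hjk
      refine Set.disjoint_left.mpr fun ω hj hk => hjk ?_
      exact arrivedBefore_unique hj.1 hj.2.1 hk.1 hk.2.1
    · exact fun k _ => measurableSet_lostDuring hB N n k
  have hlow : ∀ J, E 0 - E J ≤ P.real {ω | ∃ k, LostDuring N (fun i => B i ω) n k} := by
    intro J
    rw [← hfin]
    refine measureReal_mono fun ω hω => ?_
    simp only [mem_iUnion] at hω
    obtain ⟨k, -, hk⟩ := hω
    exact ⟨k, hk⟩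
  have hupp : ∀ J, P.real {ω | ∃ k, LostDuring N (fun i => B i ω) n k} ≤ E 0 - E J + p J := by
    intro J
    rw [← hfin]
    refine le_trans (measureReal_mono ?_) (measureReal_union_le _ _)
    rintro ω ⟨k, hk⟩
    by_cases hkJ : k < J
    · exact Or.inl (mem_biUnion (Finset.mem_range.mpr hkJ) hk)
    · exact Or.inr ((arrivedBefore_mono _ (not_lt.mp hkJ)).trans hk.1)
  rw [← hE0]
  refine le_antisymm (le_of_tendsto_of_tendsto' tendsto_const_nhds
    (by simpa using hlim.const_add (E 0)) fun J => ?_) (le_of_tendsto_of_tendsto'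
    (by simpa using tendsto_const_nhds.sub hlim) tendsto_const_nhds fun J => ?_)
  · linarith [hupp J, (hEp J).1]
  · linarith [hlow J, (hEp J).2]

theorem ae_exists_lt_arrivedBefore (ha : ∀ b, 0 < a b) (hsum : HasSum a 1)
    (hv : ∀ b, 0 < v b) (hvsum : HasSum v 1) (hB : ∀ k, Measurable (B k))
    (hlaw : ∀ (b : ℕ → ℕ) (k : ℕ), P {ω | ∀ i < k, B i ω = b i} =
      ∏ i ∈ Finset.range k, ENNReal.ofReal (activityLaw a v (level N b i) (b i))) (n : ℕ) :
    ∀ᵐ ω ∂P, ∃ k, n < arrivedBefore (fun i => B i ω) k := by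
  rw [ae_iff]
  have h := ge_of_tendsto' (tendsto_measure_arrivedBefore_le ha hsum hv hvsum hB hlaw n)
    (b := P.real {ω | ¬∃ k, n < arrivedBefore (fun i => B i ω) k}) fun k =>
      measureReal_mono fun ω hω => not_lt.mp fun h => hω ⟨k, h⟩
  exact (measureReal_eq_zero_iff).mp (le_antisymm h measureReal_nonneg)

end Chain

/-! ### The loss probability in a stationary queue -/

section Queue

variable {Ω : Type*} [MeasurableSpace Ω] {P : Measure Ω} [IsProbabilityMeasure P]
  {lam : ℝ} {μS μV : Measure ℝ} [IsProbabilityMeasure μS] [IsProbabilityMeasure μV]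
  {σ S V : ℕ → Ω → ℝ}

theorem measure_isLost (hlam : 0 < lam) (hS : ∀ᵐ x ∂μS, 0 ≤ x) (hV : ∀ᵐ x ∂μV, 0 ≤ x)
    (hS_ne : ¬ ∀ᵐ x ∂μS, x = 0) (hV_ne : ¬ ∀ᵐ x ∂μV, x = 0)
    (h : IsInput P lam μS μV σ S V) (N n : ℕ) :
    P.real {ω | IsLost N (fun k => σ k ω) (fun k => S k ω) (fun k => V k ω) n} =
      lossFrom (poissonMix lam μS) (poissonMix lam μV) N n 0 := by
  have ha := poissonMix_pos hlam hS hS_ne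
  have hsum := hasSum_poissonMix hlam hS
  have hv := poissonMix_pos hlam hV hV_ne
  have hvsum := hasSum_poissonMix hlam hV
  obtain ⟨B, hBdef⟩ : ∃ B : ℕ → Ω → ℕ, ∀ i ω, B i ω =
      arrivalsDuring N (fun n => σ n ω) (fun n => S n ω) (fun n => V n ω) i := ⟨_, fun _ _ => rfl⟩
  have hfun : ∀ ω, (fun i => B i ω) =
      arrivalsDuring N (fun n => σ n ω) (fun n => S n ω) (fun n => V n ω) := fun ω =>
    funext fun i => hBdef i ω
  have hB : ∀ k, Measurable (B k) := by
    intro k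
    rw [funext (hBdef k)]
    exact measurable_arrivalsDuring h.arrivals.measurable h.measurable_service
      h.measurable_vacation N k
  have hlaw : ∀ (b : ℕ → ℕ) (k : ℕ), P {ω | ∀ i < k, B i ω = b i} =
      ∏ i ∈ Finset.range k, ENNReal.ofReal
        (activityLaw (poissonMix lam μS) (poissonMix lam μV) (level N b i) (b i)) := by
    intro b k
    simp only [hBdef]
    exact measure_arrivalsDuring_eq hlam hS hV h N b k
  rw [← measure_exists_lostDuring ha hsum hv hvsum hB hlaw n]
  refine measureReal_congr ?_
  have hSnn : ∀ᵐ ω ∂P, ∀ n, 0 ≤ S n ω := ae_all_iff.mpr fun n =>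
    ae_nonneg_of_map (h.measurable_service n) (h.service_law n) hS
  have hVnn : ∀ᵐ ω ∂P, ∀ n, 0 ≤ V n ω := ae_all_iff.mpr fun n =>
    ae_nonneg_of_map (h.measurable_vacation n) (h.vacation_law n) hV
  filter_upwards [hSnn, hVnn, h.arrivals.pos, h.arrivals.strictMono, h.arrivals.tendsto,
    ae_exists_lt_arrivedBefore ha hsum hv hvsum hB hlaw n] with ω h1 h2 h3 h4 h5 h6
  rw [hfun] at h6
  have := isLost_iff_exists_lostDuring (N := N) h4 h5 h3 h1 h2 h6
  rw [← hfun] at this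
  exact propext this

theorem isLossProbability (hlam : 0 < lam) (hS : ∀ᵐ x ∂μS, 0 ≤ x) (hV : ∀ᵐ x ∂μV, 0 ≤ x)
    (hS_ne : ¬ ∀ᵐ x ∂μS, x = 0) (hV_ne : ¬ ∀ᵐ x ∂μV, x = 0)
    (hS_int : Integrable (fun x : ℝ => x) μS) (hV_int : Integrable (fun x : ℝ => x) μV)
    (h : IsInput P lam μS μV σ S V) {N : ℕ} (hN : 1 ≤ N) :
    IsLossProbability P N σ S V
      (1 - cycleServices (poissonMix lam μS) (poissonMix lam μV) N / (lam * ∫ x, x ∂μV +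
        cycleServices (poissonMix lam μS) (poissonMix lam μV) N * (lam * ∫ x, x ∂μS))) := by
  have ha := poissonMix_pos hlam hS hS_ne
  have hsum := hasSum_poissonMix hlam hS
  have hv := poissonMix_pos hlam hV hV_ne
  have hvsum := hasSum_poissonMix hlam hV
  unfold IsLossProbability
  simp only [measure_isLost hlam hS hV hS_ne hV_ne h]
  refine tendsto_loss ha hsum hv hvsum (hasSum_natCast_mul_poissonMix hlam hS hS_int)
    (hasSum_natCast_mul_poissonMix hlam hV hV_int) hN (K := 1) (fun n x _ => ?_)
    (fun n x hx => lossFrom_eq hv hvsum n x hx)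
  have := lossFrom_mem_Icc (N := N) ha hsum hv hvsum n x
  rw [abs_of_nonneg this.1]
  exact this.2

end Queue

/-! ### Asymptotics of the loss probability and proof of the theorem -/

theorem integral_id_pos {μ : Measure ℝ} (hμ : ∀ᵐ x ∂μ, 0 ≤ x)
    (hint : Integrable (fun x : ℝ => x) μ) (hne : ¬ ∀ᵐ x ∂μ, x = 0) : 0 < ∫ x, x ∂μ := by
  refine (integral_nonneg_of_ae hμ).lt_of_ne fun h => hne ?_
  exact (integral_eq_zero_iff_of_nonneg_ae hμ hint).mp h.symm

/-- The asymptotics of `1 - x / (mv + x * ma)` as `x` grows geometrically. -/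
theorem tendsto_loss_asymptotics {x : ℕ → ℝ} {z L mv ma : ℝ} (hz : z ∈ Ioo (0 : ℝ) 1)
    (hx : ∀ N ≥ 1, 0 < x N) (hlim : Tendsto (fun N => z ^ N * x N) atTop (𝓝 L)) (hL : 0 < L)
    (hmv : 0 < mv) (hma : 0 < ma) :
    Tendsto (fun N : ℕ => z ^ (-(N : ℤ)) * (1 - x N / (mv + x N * ma) - (1 - 1 / ma))) atTop
      (𝓝 (mv / (ma * (ma * L)))) := by
  have h1 : Tendsto (fun N : ℕ => mv / (ma * (z ^ N * mv + ma * (z ^ N * x N)))) atTop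
      (𝓝 (mv / (ma * (0 * mv + ma * L)))) := by
    refine Tendsto.div tendsto_const_nhds ?_ (by positivity)
    refine Tendsto.const_mul _ ?_
    exact ((tendsto_pow_atTop_nhds_zero_of_lt_one hz.1.le hz.2).mul_const mv).add
      (hlim.const_mul ma)
  rw [zero_mul, zero_add] at h1
  refine h1.congr' ?_
  filter_upwards [eventually_ge_atTop 1] with N hN
  have hxN := hx N hN
  have hzN : 0 < z ^ N := pow_pos hz.1 N
  have h2 : mv + x N * ma ≠ 0 := by positivity
  have h3 : z ^ N * mv + ma * (z ^ N * x N) ≠ 0 := by positivity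
  rw [zpow_neg, zpow_natCast]
  field_simp
  ring

end VacationQueue

open VacationQueue in
theorem theorem3p4 {Ω : Type*} [MeasurableSpace Ω] (P : Measure Ω) [IsProbabilityMeasure P]
    (lam : ℝ) (hlam : 0 < lam)
    (μS μV : Measure ℝ) [IsProbabilityMeasure μS] [IsProbabilityMeasure μV]
    (hS_nonneg : ∀ᵐ x ∂μS, 0 ≤ x) (hV_nonneg : ∀ᵐ x ∂μV, 0 ≤ x)
    (hS_int : Integrable (fun x : ℝ => x) μS) (hV_int : Integrable (fun x : ℝ => x) μV)
    (hV_ne : ¬ ∀ᵐ x ∂μV, x = 0)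
    (σ S V : ℕ → Ω → ℝ) (hinput : VacationQueue.IsInput P lam μS μV σ S V)
    (ES EV ρ : ℝ) (hES : ES = ∫ x, x ∂μS) (hEV : EV = ∫ x, x ∂μV) (hρ : ρ = lam * ES)
    (hρ_gt : 1 < ρ) :
    ∃ z₂ ∈ Set.Ioo (0 : ℝ) 1,
      z₂ = VacationQueue.laplace μS (lam - lam * z₂) ∧
      (∀ z ∈ Set.Ioo (0 : ℝ) 1, z = VacationQueue.laplace μS (lam - lam * z) → z = z₂) ∧
      ∃ Ploss : ℕ → ℝ,
        (∀ N : ℕ, 1 ≤ N → VacationQueue.IsLossProbability P N σ S V (Ploss N)) ∧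
        Tendsto (fun N : ℕ => z₂ ^ (-(N : ℤ)) * (Ploss N - (1 - 1 / ρ))) atTop
          (𝓝 (((1 - z₂) *
                (1 - deriv (fun u => VacationQueue.laplace μS (lam - lam * u)) z₂) * EV) /
              (z₂ * ρ * ES * (1 - VacationQueue.laplace μV (lam - lam * z₂))))) := by
  have hS_ne : ¬ ∀ᵐ x ∂μS, x = 0 := by
    intro h
    have : ∫ x, x ∂μS = 0 := integral_eq_zero_of_ae h
    rw [hρ, hES, this, mul_zero] at hρ_gt
    linarith
  have ha := poissonMix_pos hlam hS_nonneg hS_ne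
  have hsum := hasSum_poissonMix hlam hS_nonneg
  have hv := poissonMix_pos hlam hV_nonneg hV_ne
  have hvsum := hasSum_poissonMix hlam hV_nonneg
  have hma := hasSum_natCast_mul_poissonMix hlam hS_nonneg hS_int
  rw [← hES, ← hρ] at hma
  have hEV0 : 0 < EV := hEV ▸ integral_id_pos hV_nonneg hV_int hV_ne
  have hES0 : 0 < ES := hES ▸ integral_id_pos hS_nonneg hS_int hS_ne
  have hgen : ∀ u ∈ Ioo (0 : ℝ) 1, tailGen (poissonMix lam μS) u =
      (1 - laplace μS (lam - lam * u)) / (1 - u) := fun u hu =>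
    (hasSum_tail_mul_pow (fun b => (ha b).le) hsum hu.1.le hu.2
      (hasSum_pow_mul_poissonMix hlam hS_nonneg hu.1.le hu.2.le)).tsum_eq
  -- Dividing by $1 - u$ removes the trivial fixed point $u = 1$.
  have hfix : ∀ u ∈ Ioo (0 : ℝ) 1, u = laplace μS (lam - lam * u) ↔
      tailGen (poissonMix lam μS) u = 1 := by
    intro u hu
    rw [hgen u hu, div_eq_one_iff_eq (by linarith [hu.2])]
    constructor <;> intro h <;> linarith
  obtain ⟨z, hz, hz1, huniq⟩ := existsUnique_tailGen_eq_one ha hsum hma hρ_gt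
  refine ⟨z, hz, (hfix z hz).mpr hz1, fun y hy hy1 => huniq y hy ((hfix y hy).mp hy1), _,
    fun N hN => isLossProbability hlam hS_nonneg hV_nonneg hS_ne hV_ne hS_int hV_int hinput hN, ?_⟩
  have hz0 := hz.1
  have hz1' : 0 < 1 - z := by linarith [hz.2]
  have hvgen : tailGen (poissonMix lam μV) z = (1 - laplace μV (lam - lam * z)) / (1 - z) :=
    (hasSum_tail_mul_pow (fun b => (hv b).le) hvsum hz.1.le hz.2
      (hasSum_pow_mul_poissonMix hlam hV_nonneg hz.1.le hz.2.le)).tsum_eq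
  have hvpos : 0 < tailGen (poissonMix lam μV) z := by
    have hs := hasSum_tail_mul_pow (fun b => (hv b).le) hvsum hz.1.le hz.2
      (hasSum_pow_mul_poissonMix hlam hV_nonneg hz.1.le hz.2.le)
    have ht := tail_pos hv hvsum
    exact hs.summable.tsum_pos (fun i => mul_nonneg (ht i).le (by positivity)) 0
      (by simpa using ht 0)
  have hderiv := one_sub_deriv_gen (fun b => (ha b).le) hsum
    (A := fun u => laplace μS (lam - lam * u))
    (fun u hu => hasSum_pow_mul_poissonMix hlam hS_nonneg hu.1 hu.2) hz hz1
  set D := ∑' i : ℕ, (i : ℝ) * (tail (poissonMix lam μS) i * z ^ i) with hD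
  set δ := deriv (fun u => laplace μS (lam - lam * u)) z with hδ
  have hDpos : 0 < D := by
    have ht := tail_pos ha hsum
    refine (summable_natCast_mul_tail_mul_pow (fun b => (ha b).le) hsum hz).tsum_pos
      (fun i => mul_nonneg (Nat.cast_nonneg i) (mul_nonneg (ht i).le (by positivity))) 1 ?_
    simpa using mul_pos (ht 1) hz0
  have hlim := tendsto_cycleServices ha hsum hv hvsum hz hz1
  rw [← hD] at hlim
  rw [← hES, ← hEV, ← hρ]
  have h := tendsto_loss_asymptotics (mv := lam * EV) (ma := ρ) hz
    (fun N hN => cycleServices_pos ha hsum hv hvsum hN) hlim (by positivity) (by positivity)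
    (by linarith)
  convert h using 2
  -- The mean `D` of the renewal law and the tail generating function of the vacations are traded
  -- for the transforms; $\rho = \lambda E[S]$ then turns $\lambda/\rho^2$ into $1/(\rho E[S])$.
  have hδ' : 1 - δ = (1 - z) * D / z := by
    rw [eq_div_iff hz0.ne']
    exact hderiv
  have hW : 1 - laplace μV (lam - lam * z) = tailGen (poissonMix lam μV) z * (1 - z) := by
    rw [hvgen, div_mul_cancel₀ _ hz1'.ne']
  rw [hδ', hW, hρ]
  field_simp
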